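/- **Setting.** For $y=(y_1,y_2)\in\mathbb R^2$ and $\rho\in(-1,1)$ let $$\psi(y,\rho)=\frac{1}{2\pi\sqrt{1-\rho^2}}\exp\Big\{-\frac{y_1^2-2\rho y_1y_2+y_2^2}{2(1-\rho^2)}\Big\},\qquad u(y,\rho)=\frac{\partial}{\partial\rho}\log\psi(y,\rho).$$ Let $K:\mathbb R^2\to\mathbb R$ be an even kernel with $\int K=1$, and for $h=(h_1,h_2)>0$ let $K_h(x)=(h_1h_2)^{-1}K(x_1/h_1,x_2/h_2)$. Let $\{Z_t\}_{t\ge1}$ be identically distributed random vectors in $\mathbb R^2$ (not necessarily independent) with standard normal margins and joint density $f$, and fix $z\in\mathbb R^2$. Assume that $f$ is continuous at $z$ and that $(1+|y|^2)f(y)$ is bounded on $\mathbb R^2$. Let $\Theta\subset(-1,1)$ be the parameter space and $J$ an interval with $\Theta\subseteq J\subseteq(-1,1)$ (for instance $J=(-1,1)$, or $J=\Theta$ if $\Theta$ is an interval). **Assumptions.** 1. (Local Gaussian correlation.) There is $\rho_0=\rho_0(z)\in\Theta$ with $\psi(z,\rho_0)=f(z)$ such that for any sequence of positive bandwidth vectors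 $h_n\to0$ and for all large $n$, the equation $$\int K_{h_n}(y-z)\,u(y,\rho)\,\{f(y)-\psi(y,\rho)\}\,dy=0$$ has exactly one solution $\rho=\rho_{h_n}$ in $J$, and $\rho_{h_n}\to\rho_0$. 2. (Mixing.) With $\alpha(m)=\sup_k\sup\{|P(A)P(B)-P(A\cap B)|: A\in\sigma(Z_t,\,t\le k),\ B\in\sigma(Z_t,\,t\ge k+m)\}$, there are $\delta>2$ and $\lambda>1-2/\delta$ with $\sum_{m\ge1}m^\lambda\alpha(m)^{1-2/\delta}<\infty$. 3. (Bandwidths.) The bandwidths $h_n=(h_{n,1},h_{n,2})>0$ tend to $0$, and for some $\varepsilon_0>0$ and $c>0$, $\;n\,(h_{n,1}h_{n,2})^{\frac{\lambda+2-2/\delta}{\lambda+2/\delta}}\ge c\,n^{\varepsilon_0}$ for all large $n$. 4. (Compactness.) $\Theta$ is a compact subset of $(-1,1)$. 5. (Kernel.) $\sup|K|<\infty$, $\int|K|<\infty$, the partial derivatives of $K$ exist and are finite, and for $i=1,2$, $|z_iK(z)|\to0$ as $z_i\to\infty$ with the other coordinate fixed. **Theorem.** For each $n$ let $\widehat\rho_n(z)$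 be a maximizer over $\rho\in\Theta$ of the local log-likelihood $$L_n(\rho,z)=\frac1n\sum_{t=1}^nK_{h_n}(Z_t-z)\log\psi(Z_t,\rho)-\int K_{h_n}(y-z)\,\psi(y,\rho)\,dy .$$ Then $\widehat\rho_n(z)\to\rho_0(z)$ in probability as $n\to\infty$. -/

import Mathlib

open MeasureTheory ProbabilityTheory Filter Topology Asymptotics

noncomputable section

namespace LocalGaussian

/-- The bivariate normal density with zero means, unit variances and correlation `ρ`. -/
def psi (y : ℝ × ℝ) (ρ : ℝ) : ℝ :=
  (2 * Real.pi)⁻¹ * (Real.sqrt (1 - ρ ^ 2))⁻¹ *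
    Real.exp (-((y.1 ^ 2 - 2 * ρ * y.1 * y.2 + y.2 ^ 2) / (2 * (1 - ρ ^ 2))))

/-- The score `u(y, ρ) = ∂ log ψ(y, ρ) / ∂ρ`. -/
def score (y : ℝ × ℝ) (ρ : ℝ) : ℝ :=
  deriv (fun r : ℝ => Real.log (psi y r)) ρ

/-- The scaled kernel `K_h(x) = |h|⁻¹ K(h⁻¹ x)` for the diagonal bandwidth matrix
`h = diag(h₁, h₂)`. -/
def scaledKernel (K : ℝ × ℝ → ℝ) (h : ℝ × ℝ) (x : ℝ × ℝ) : ℝ :=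
  (h.1 * h.2)⁻¹ * K (x.1 / h.1, x.2 / h.2)

/-- The local log-likelihood
`L_n(ρ; z) = n⁻¹ ∑_{t<n} K_h(X_t - z) log ψ(X_t, ρ) - ∫ K_h(y - z) ψ(y, ρ) dy`
of the observations `X_0, …, X_{n-1}`. -/
def localLogLik (K : ℝ × ℝ → ℝ) (h z : ℝ × ℝ) (n : ℕ) (X : ℕ → ℝ × ℝ) (ρ : ℝ) : ℝ :=
  (n : ℝ)⁻¹ * ∑ t ∈ Finset.range n, scaledKernel K h (X t - z) * Real.log (psi (X t) ρ)
    - ∫ y : ℝ × ℝ, scaledKernel K h (y - z) * psi y ρ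

/-- The population local score
`∫ K_h(y - z) u(y, ρ) (f(y) - ψ(y, ρ)) dy`. -/
def localScore (K f : ℝ × ℝ → ℝ) (h z : ℝ × ℝ) (ρ : ℝ) : ℝ :=
  ∫ y : ℝ × ℝ, scaledKernel K h (y - z) * score y ρ * (f y - psi y ρ)

/-- `ρ₀` is the local Gaussian correlation at `z` of a pair with joint density `f`, relative to the
kernel `K` and the set `J` of admissible correlations: for any sequence of bandwidths tending to
zero, the population local score equation has (for all large `n`) exactly one solution `r n` in
`J`, these solutions converge to `ρ₀`, and `ψ(z, ρ₀) = f(z)`. -/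
structure IsLocalGaussianCorrelation (K f : ℝ × ℝ → ℝ) (J : Set ℝ) (z : ℝ × ℝ) (ρ₀ : ℝ) :
    Prop where
  exists_unique_tendsto : ∀ h : ℕ → ℝ × ℝ, (∀ n, 0 < (h n).1 ∧ 0 < (h n).2) →
    Tendsto h atTop (𝓝 (0, 0)) →
    ∃ r : ℕ → ℝ,
      (∀ᶠ n in atTop, r n ∈ J ∧ ∀ ρ ∈ J, localScore K f (h n) z ρ = 0 ↔ ρ = r n) ∧
      Tendsto r atTop (𝓝 ρ₀)
  population : psi z ρ₀ = f z

/-- Regularity conditions on the kernel: even, integrating to one, bounded, absolutely integrable,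
with finite partial derivatives, and with `z_i K(z) → 0` as `z_i → ∞`. -/
structure IsAdmissibleKernel (K : ℝ × ℝ → ℝ) : Prop where
  even : ∀ y, K (-y) = K y
  integral_eq_one : ∫ y, K y = 1
  bounded : ∃ M : ℝ, ∀ y, |K y| ≤ M
  integrable : Integrable K
  partial_fst : ∀ y : ℝ × ℝ, DifferentiableAt ℝ (fun t => K (t, y.2)) y.1
  partial_snd : ∀ y : ℝ × ℝ, DifferentiableAt ℝ (fun t => K (y.1, t)) y.2
  tail_fst : ∀ s : ℝ, Tendsto (fun t : ℝ => |t * K (t, s)|) atTop (𝓝 0)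
  tail_snd : ∀ s : ℝ, Tendsto (fun t : ℝ => |t * K (s, t)|) atTop (𝓝 0)

/-- The σ-algebra generated by `Z t`, `t ∈ S`. -/
abbrev sigmaGen {Ω : Type*} (Z : ℕ → Ω → ℝ × ℝ) (S : Set ℕ) : MeasurableSpace Ω :=
  ⨆ t ∈ S, MeasurableSpace.comap (Z t) inferInstance

/-- The `α`-mixing coefficient
`α(m) = sup_k sup { |P(A) P(B) - P(A ∩ B)| : A ∈ σ(Z_t, t ≤ k), B ∈ σ(Z_t, t ≥ k + m) }`.
For a strictly stationary sequence the supremum over `k` is the usual coefficient. -/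
def alphaMixing {Ω : Type*} [MeasurableSpace Ω] (μ : Measure Ω) (Z : ℕ → Ω → ℝ × ℝ) (m : ℕ) : ℝ :=
  sSup {x : ℝ | ∃ (k : ℕ) (A B : Set Ω),
    MeasurableSet[sigmaGen Z (Set.Iic k)] A ∧ MeasurableSet[sigmaGen Z (Set.Ici (k + m))] B ∧
    x = |μ.real A * μ.real B - μ.real (A ∩ B)|}

end LocalGaussian

end

noncomputable section

namespace LocalGaussian

/-! This is the consistency argument for an M-estimator: on `Θ` the local log-likelihood converges
uniformly in probability to `limitLogLik`, whose maximum at `ρ₀` is well separated.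

Uniformity in ρ reduces to three weak laws, because log ψ(y, ρ) is a combination of 1, y₁² + y₂² and
y₁y₂ with coefficients bounded on `Θ` (`log_psi`). The averages are handled by
`tendsto_measureReal_kernelMean`, the deterministic penalty by `eventually_abs_integral_psi_sub_lt`.

In the weak law the statistic is cut off outside the unit ball about z. The outer part vanishes in
L¹; the inner part is bounded, and Chebyshev applies. With H = h₁h₂, each covariance at lag m is
O(1/H) by second moments and O(α(m)/H²) by mixing. Geometric interpolation with weight b turns this
into α(m)^b / H^(1+b), so the variance is O(1/(n H^(1+b))). For b = (1 - 2/δ)/(λ + 2/δ), Young's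
inequality makes α^b summable, and the bandwidth exponent is 1 + 2b, more than enough.

The limit f(z) log ψ - ψ is largest exactly where ψ(z, ρ) = f(z). Two such points in `J` would
enclose a sign change of its derivative from negative to positive. The population scores then have
zeros trapped strictly between the two points, and by uniqueness these zeros converge to `ρ₀`.
Taking `ρ₀` as one of the two points is a contradiction (`IsLocalGaussianCorrelation.eq_of_psi_eq`).
-/

/-! ### The bivariate normal density and its score -/

lemma one_sub_sq_pos {ρ : ℝ} (hρ : ρ ∈ Set.Ioo (-1 : ℝ) 1) : 0 < 1 - ρ ^ 2 := by
  nlinarith [hρ.1, hρ.2]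

lemma exists_le_one_sub_sq {S : Set ℝ} (hS : IsCompact S) (hS1 : S ⊆ Set.Ioo (-1) 1) :
    ∃ κ : ℝ, 0 < κ ∧ ∀ ρ ∈ S, κ ≤ 1 - ρ ^ 2 :=
  hS.exists_forall_le' (f := fun ρ : ℝ => 1 - ρ ^ 2) (by fun_prop)
    fun ρ hρ => one_sub_sq_pos (hS1 hρ)

lemma psi_pos (y : ℝ × ℝ) {ρ : ℝ} (hρ : ρ ∈ Set.Ioo (-1 : ℝ) 1) : 0 < psi y ρ := by
  have := Real.sqrt_pos.2 (one_sub_sq_pos hρ)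
  unfold psi
  positivity

/-- The logarithm of the bivariate normal density is affine in `y₁² + y₂²` and `y₁ y₂`. -/
lemma log_psi (y : ℝ × ℝ) {ρ : ℝ} (hρ : ρ ∈ Set.Ioo (-1 : ℝ) 1) :
    Real.log (psi y ρ) = (-Real.log (2 * Real.pi) - Real.log (1 - ρ ^ 2) / 2)
      + (-(2 * (1 - ρ ^ 2))⁻¹) * (y.1 ^ 2 + y.2 ^ 2) + ρ * (1 - ρ ^ 2)⁻¹ * (y.1 * y.2) := by
  have h0 := one_sub_sq_pos hρ
  have h1 := Real.sqrt_pos.2 h0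
  have h2 : (0 : ℝ) < 2 * Real.pi := by positivity
  unfold psi
  rw [Real.log_mul (by positivity) (by positivity), Real.log_mul (by positivity) (by positivity),
    Real.log_exp, Real.log_inv, Real.log_inv, Real.log_sqrt h0.le]
  field_simp
  ring

lemma hasDerivAt_log_psi (y : ℝ × ℝ) {ρ : ℝ} (hρ : ρ ∈ Set.Ioo (-1 : ℝ) 1) :
    HasDerivAt (fun r : ℝ => Real.log (psi y r))
      ((ρ * (1 - ρ ^ 2) + (1 + ρ ^ 2) * (y.1 * y.2) - ρ * (y.1 ^ 2 + y.2 ^ 2))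
        / (1 - ρ ^ 2) ^ 2) ρ := by
  have h0 := one_sub_sq_pos hρ
  have e : (fun r : ℝ => Real.log (psi y r)) =ᶠ[𝓝 ρ] fun r =>
      (-Real.log (2 * Real.pi) - Real.log (1 - r ^ 2) / 2)
      + (-(2 * (1 - r ^ 2))⁻¹) * (y.1 ^ 2 + y.2 ^ 2) + r * (1 - r ^ 2)⁻¹ * (y.1 * y.2) := by
    filter_upwards [isOpen_Ioo.mem_nhds hρ] with r hr using log_psi y hr
  refine HasDerivAt.congr_of_eventuallyEq ?_ e
  have d0 : HasDerivAt (fun r : ℝ => 1 - r ^ 2) (-(2 * ρ)) ρ := by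
    simpa using ((hasDerivAt_pow 2 ρ).const_sub 1)
  have d1 := (d0.log h0.ne').div_const 2
  have d2 := ((d0.const_mul 2).inv (by positivity)).neg
  have d3 := (hasDerivAt_id ρ).mul (d0.inv h0.ne')
  have d4 := ((d1.const_sub (-Real.log (2 * Real.pi))).add (d2.mul_const (y.1 ^ 2 + y.2 ^ 2))).add
    (d3.mul_const (y.1 * y.2))
  refine d4.congr_deriv ?_
  simp only [Pi.inv_apply, id]
  field_simp
  ring

lemma score_eq (y : ℝ × ℝ) {ρ : ℝ} (hρ : ρ ∈ Set.Ioo (-1 : ℝ) 1) :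
    score y ρ = (ρ * (1 - ρ ^ 2) + (1 + ρ ^ 2) * (y.1 * y.2) - ρ * (y.1 ^ 2 + y.2 ^ 2))
        / (1 - ρ ^ 2) ^ 2 :=
  (hasDerivAt_log_psi y hρ).deriv

lemma hasDerivAt_log_psi_score (y : ℝ × ℝ) {ρ : ℝ} (hρ : ρ ∈ Set.Ioo (-1 : ℝ) 1) :
    HasDerivAt (fun r : ℝ => Real.log (psi y r)) (score y ρ) ρ := by
  rw [score_eq y hρ]; exact hasDerivAt_log_psi y hρ

lemma hasDerivAt_psi (y : ℝ × ℝ) {ρ : ℝ} (hρ : ρ ∈ Set.Ioo (-1 : ℝ) 1) :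
    HasDerivAt (psi y) (psi y ρ * score y ρ) ρ := by
  have h1 := (hasDerivAt_log_psi_score y hρ).exp
  rw [Real.exp_log (psi_pos y hρ)] at h1
  refine h1.congr_of_eventuallyEq ?_
  filter_upwards [isOpen_Ioo.mem_nhds hρ] with r hr using (Real.exp_log (psi_pos y hr)).symm

lemma continuous_psi_left (ρ : ℝ) : Continuous fun y : ℝ × ℝ => psi y ρ := by
  unfold psi; fun_prop

lemma continuousOn_psi :
    ContinuousOn (fun p : (ℝ × ℝ) × ℝ => psi p.1 p.2) (Set.univ ×ˢ Set.Ioo (-1 : ℝ) 1) := by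
  unfold psi
  have h : ∀ p ∈ (Set.univ ×ˢ Set.Ioo (-1 : ℝ) 1 : Set ((ℝ × ℝ) × ℝ)), 0 < 1 - p.2 ^ 2 :=
    fun p hp => one_sub_sq_pos hp.2
  refine ContinuousOn.mul (continuousOn_const.mul (ContinuousOn.inv₀ (by fun_prop) ?_))
    (Real.continuous_exp.comp_continuousOn (ContinuousOn.neg (ContinuousOn.div (by fun_prop)
      (by fun_prop) ?_)))
  · intro p hp; exact (Real.sqrt_pos.2 (h p hp)).ne'
  · intro p hp; have := h p hp; positivity

lemma continuousOn_psi_right (y : ℝ × ℝ) : ContinuousOn (psi y) (Set.Ioo (-1) 1) :=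
  fun _ hρ => (hasDerivAt_psi y hρ).continuousAt.continuousWithinAt

lemma continuousOn_score_right (y : ℝ × ℝ) : ContinuousOn (score y) (Set.Ioo (-1) 1) := by
  have : ContinuousOn (fun ρ : ℝ => (ρ * (1 - ρ ^ 2) + (1 + ρ ^ 2) * (y.1 * y.2)
      - ρ * (y.1 ^ 2 + y.2 ^ 2)) / (1 - ρ ^ 2) ^ 2) (Set.Ioo (-1) 1) :=
    ContinuousOn.div (by fun_prop) (by fun_prop)
      fun ρ hρ => (pow_pos (one_sub_sq_pos hρ) 2).ne'
  exact this.congr fun ρ hρ => score_eq y hρ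

lemma continuous_score_left {ρ : ℝ} (hρ : ρ ∈ Set.Ioo (-1 : ℝ) 1) :
    Continuous fun y : ℝ × ℝ => score y ρ := by
  simp_rw [fun y => score_eq y hρ]; fun_prop

/-- Gaussian decay beats the quadratic weight uniformly in ρ, because the correlation matrix has
eigenvalues 1 ± ρ, at most 2. -/
lemma weight_mul_psi_le (y : ℝ × ℝ) {ρ κ : ℝ} (hρ : ρ ∈ Set.Ioo (-1 : ℝ) 1) (hκ : 0 < κ)
    (hκρ : κ ≤ 1 - ρ ^ 2) : (1 + y.1 ^ 2 + y.2 ^ 2) * psi y ρ ≤ (Real.sqrt κ)⁻¹ := by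
  have h0 := one_sub_sq_pos hρ
  set s := y.1 ^ 2 + y.2 ^ 2 with hs
  have hs0 : 0 ≤ s := by positivity
  have h1 : s / 4 ≤ (y.1 ^ 2 - 2 * ρ * y.1 * y.2 + y.2 ^ 2) / (2 * (1 - ρ ^ 2)) := by
    rw [le_div_iff₀ (by positivity)]
    have ha : 0 ≤ (1 + ρ) := by linarith [hρ.1]
    have hb : 0 ≤ (1 - ρ) := by linarith [hρ.2]
    nlinarith [mul_nonneg (mul_nonneg ha ha) (sq_nonneg (y.1 - y.2)),
      mul_nonneg (mul_nonneg hb hb) (sq_nonneg (y.1 + y.2))]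
  have h2 : Real.exp (-((y.1 ^ 2 - 2 * ρ * y.1 * y.2 + y.2 ^ 2) / (2 * (1 - ρ ^ 2))))
      ≤ Real.exp (-(s / 4)) := Real.exp_le_exp.2 (by linarith)
  -- From 1 + s ≤ 4(1 + s/4) ≤ 4 exp(s/4); the 4 is later cancelled by 1/(2π) ≤ 1/4.
  have h3 : (1 + s) * Real.exp (-(s / 4)) ≤ 4 := by
    rw [Real.exp_neg, ← div_eq_mul_inv, div_le_iff₀ (Real.exp_pos _)]
    nlinarith [Real.add_one_le_exp (s / 4)]
  have h4 : (Real.sqrt (1 - ρ ^ 2))⁻¹ ≤ (Real.sqrt κ)⁻¹ :=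
    inv_anti₀ (Real.sqrt_pos.2 hκ) (Real.sqrt_le_sqrt hκρ)
  have h5 : (2 * Real.pi)⁻¹ ≤ 4⁻¹ := inv_anti₀ (by norm_num) (by linarith [Real.pi_gt_three])
  have hi : 0 ≤ (Real.sqrt (1 - ρ ^ 2))⁻¹ := by positivity
  calc (1 + y.1 ^ 2 + y.2 ^ 2) * psi y ρ
      = ((2 * Real.pi)⁻¹ * (Real.sqrt (1 - ρ ^ 2))⁻¹) * ((1 + s) *
        Real.exp (-((y.1 ^ 2 - 2 * ρ * y.1 * y.2 + y.2 ^ 2) / (2 * (1 - ρ ^ 2))))) := by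
        unfold psi; rw [hs]; ring
    _ ≤ (4⁻¹ * (Real.sqrt κ)⁻¹) * 4 := by
        gcongr
        exact (mul_le_mul_of_nonneg_left h2 (by positivity)).trans h3
    _ = _ := by ring

lemma abs_score_le (y : ℝ × ℝ) {ρ κ : ℝ} (hρ : ρ ∈ Set.Ioo (-1 : ℝ) 1) (hκ : 0 < κ)
    (hκρ : κ ≤ 1 - ρ ^ 2) : |score y ρ| ≤ 2 / κ ^ 2 * (1 + y.1 ^ 2 + y.2 ^ 2) := by
  have h0 := one_sub_sq_pos hρ
  rw [score_eq y hρ, abs_div, abs_of_pos (pow_pos h0 2)]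
  have hρ1 : |ρ| ≤ 1 := abs_le.2 ⟨hρ.1.le, hρ.2.le⟩
  have h1 : |ρ * (1 - ρ ^ 2)| ≤ 1 := by
    rw [abs_mul, abs_of_pos h0]; nlinarith [abs_nonneg ρ, sq_nonneg ρ]
  have h2 : |(1 + ρ ^ 2) * (y.1 * y.2)| ≤ y.1 ^ 2 + y.2 ^ 2 := by
    rw [abs_mul, abs_of_pos (by positivity : 0 < 1 + ρ ^ 2), abs_mul]
    nlinarith [sq_abs y.1, sq_abs y.2, sq_nonneg (|y.1| - |y.2|), abs_nonneg y.1, abs_nonneg y.2,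
      mul_nonneg (abs_nonneg y.1) (abs_nonneg y.2)]
  have h3 : |ρ * (y.1 ^ 2 + y.2 ^ 2)| ≤ y.1 ^ 2 + y.2 ^ 2 := by
    rw [abs_mul, abs_of_nonneg (by positivity : 0 ≤ y.1 ^ 2 + y.2 ^ 2)]
    exact mul_le_of_le_one_left (by positivity) hρ1
  have h4 : |ρ * (1 - ρ ^ 2) + (1 + ρ ^ 2) * (y.1 * y.2) - ρ * (y.1 ^ 2 + y.2 ^ 2)|
      ≤ 2 * (1 + y.1 ^ 2 + y.2 ^ 2) := by
    refine (abs_sub _ _).trans ?_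
    linarith [abs_add_le (ρ * (1 - ρ ^ 2)) ((1 + ρ ^ 2) * (y.1 * y.2))]
  rw [div_mul_eq_mul_div]
  exact div_le_div₀ (by positivity) h4 (by positivity) (by gcongr)

/-- The score vanishes on no interval: its numerator is a cubic in `ρ`. -/
lemma exists_score_ne_zero (y : ℝ × ℝ) {a b : ℝ} (hab : a < b)
    (h : Set.Ioo a b ⊆ Set.Ioo (-1) 1) : ∃ ρ ∈ Set.Ioo a b, score y ρ ≠ 0 := by
  by_contra! hc
  let p : Polynomial ℝ := Polynomial.X * (1 - Polynomial.X ^ 2)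
    + (1 + Polynomial.X ^ 2) * Polynomial.C (y.1 * y.2)
    - Polynomial.X * Polynomial.C (y.1 ^ 2 + y.2 ^ 2)
  have hp : p = 0 := by
    refine Polynomial.eq_zero_of_infinite_isRoot p ((Set.Ioo_infinite hab).mono fun ρ hρ => ?_)
    have h1 := hc ρ hρ
    rw [score_eq y (h hρ), div_eq_zero_iff] at h1
    have h2 := h1.resolve_right (pow_pos (one_sub_sq_pos (h hρ)) 2).ne'
    simpa [p, Polynomial.IsRoot] using h2
  have e : ∀ x : ℝ, p.eval x = 0 := by simp [hp]
  -- The value at 0 forces y₁y₂ = 0, the value at 1 then forces y₁² + y₂² = 0, and the value at 2 is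
  -- then -6.
  have e0 := e 0
  have e1 := e 1
  have e2 := e 2
  have e3 := e (-1)
  simp [p] at e0 e1 e2 e3
  nlinarith

/-! ### Rescaled kernels as approximate identities -/

section Population

/-- The change of variables `x ↦ z + (h₁ x₁, h₂ x₂)`. -/
def rescale (h z x : ℝ × ℝ) : ℝ × ℝ := (z.1 + h.1 * x.1, z.2 + h.2 * x.2)

lemma measurableEmbedding_rescale {h : ℝ × ℝ} (hh : 0 < h.1 ∧ 0 < h.2) (z : ℝ × ℝ) :
    MeasurableEmbedding (rescale h z) :=
  (((Homeomorph.mulLeft₀ h.1 hh.1.ne').trans (Homeomorph.addLeft z.1)).prodCongr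
    ((Homeomorph.mulLeft₀ h.2 hh.2.ne').trans (Homeomorph.addLeft z.2))).measurableEmbedding

lemma map_add_mul_volume {a : ℝ} (ha : 0 < a) (b : ℝ) :
    Measure.map (fun x : ℝ => b + a * x) volume = ENNReal.ofReal a⁻¹ • volume := by
  have h1 : (fun x : ℝ => b + a * x) = (fun x => b + x) ∘ fun x => a * x := rfl
  rw [h1, ← Measure.map_map (by fun_prop) (by fun_prop), Real.map_volume_mul_left ha.ne',
    Measure.map_smul, map_add_left_eq_self, abs_of_pos (inv_pos.2 ha)]

lemma map_rescale_volume {h : ℝ × ℝ} (hh : 0 < h.1 ∧ 0 < h.2) (z : ℝ × ℝ) :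
    Measure.map (rescale h z) volume = ENNReal.ofReal (h.1 * h.2)⁻¹ • volume := by
  have e : rescale h z = Prod.map (fun x => z.1 + h.1 * x) (fun x => z.2 + h.2 * x) := rfl
  rw [e, Measure.volume_eq_prod, ← Measure.map_prod_map _ _ (by fun_prop) (by fun_prop),
    map_add_mul_volume hh.1, map_add_mul_volume hh.2, Measure.prod_smul_left,
    Measure.prod_smul_right, smul_smul, mul_inv, ENNReal.ofReal_mul (inv_pos.2 hh.1).le]

lemma scaledKernel_rescale (K : ℝ × ℝ → ℝ) {h : ℝ × ℝ} (hh : 0 < h.1 ∧ 0 < h.2) (z x : ℝ × ℝ) :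
    scaledKernel K h (rescale h z x - z) = (h.1 * h.2)⁻¹ * K x := by
  simp [scaledKernel, rescale, mul_div_cancel_left₀, hh.1.ne', hh.2.ne']

/-- The change of variables moves the bandwidth from the kernel into the test function, so that
dominated convergence can be applied with |K| as dominating factor. -/
lemma integral_scaledKernel_mul (K G : ℝ × ℝ → ℝ) {h : ℝ × ℝ} (hh : 0 < h.1 ∧ 0 < h.2)
    (z : ℝ × ℝ) :
    ∫ y, scaledKernel K h (y - z) * G y = ∫ x, K x * G (rescale h z x) := by
  have hH : 0 < h.1 * h.2 := mul_pos hh.1 hh.2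
  have e := (measurableEmbedding_rescale hh z).integral_map (μ := volume)
    (fun y => scaledKernel K h (y - z) * G y)
  rw [map_rescale_volume hh, integral_smul_measure,
    ENNReal.toReal_ofReal (inv_pos.2 hH).le] at e
  simp_rw [scaledKernel_rescale K hh, mul_assoc, integral_const_mul] at e
  exact mul_left_cancel₀ (inv_pos.2 hH).ne' e

lemma integrable_scaledKernel_mul {K G : ℝ × ℝ → ℝ} (hK : Integrable K) (hG : Measurable G)
    {C : ℝ} (hC : ∀ y, |G y| ≤ C) {h : ℝ × ℝ} (hh : 0 < h.1 ∧ 0 < h.2) (z : ℝ × ℝ) :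
    Integrable fun y => scaledKernel K h (y - z) * G y := by
  have hH : 0 < h.1 * h.2 := mul_pos hh.1 hh.2
  have e := (measurableEmbedding_rescale hh z).integrable_map_iff (μ := volume)
    (g := fun y => scaledKernel K h (y - z) * G y)
  rw [map_rescale_volume hh, integrable_smul_measure 
    (ENNReal.ofReal_pos.2 (inv_pos.2 hH)).ne' ENNReal.ofReal_ne_top] at e
  rw [e]
  have : ((fun y => scaledKernel K h (y - z) * G y) ∘ rescale h z)
      = fun x => (h.1 * h.2)⁻¹ * K x * G (rescale h z x) := by
    funext x; simp only [Function.comp, scaledKernel_rescale K hh]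
  rw [this]
  exact (hK.const_mul _).mul_bdd
    (hG.comp (measurableEmbedding_rescale hh z).measurable).aestronglyMeasurable
    (ae_of_all _ fun x => hC _)

lemma tendsto_rescale {h : ℕ → ℝ × ℝ} (h0 : Tendsto h atTop (𝓝 (0, 0))) (z x : ℝ × ℝ) :
    Tendsto (fun n => rescale (h n) z x) atTop (𝓝 z) := by
  have : Continuous fun k : ℝ × ℝ => rescale k z x := by unfold rescale; fun_prop
  have h1 := (this.tendsto (0, 0)).comp h0
  simpa [rescale, Function.comp_def] using h1

/-- Dominated convergence after rescaling. The test function may vary with n, which later allows a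
moving correlation. -/
lemma tendsto_integral_scaledKernel_mul_zero {K : ℝ × ℝ → ℝ} (hK : Integrable K)
    {h : ℕ → ℝ × ℝ} (hh : ∀ n, 0 < (h n).1 ∧ 0 < (h n).2) (z : ℝ × ℝ)
    {G : ℕ → ℝ × ℝ → ℝ} (hG : ∀ n, Measurable (G n)) {C : ℝ} (hC : ∀ n y, |G n y| ≤ C)
    (hlim : ∀ x, Tendsto (fun n => G n (rescale (h n) z x)) atTop (𝓝 0)) :
    Tendsto (fun n => ∫ y, scaledKernel K (h n) (y - z) * G n y) atTop (𝓝 0) := by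
  simp_rw [fun n => integral_scaledKernel_mul K (G n) (hh n) z]
  have := tendsto_integral_of_dominated_convergence (μ := volume)
    (F := fun n x => K x * G n (rescale (h n) z x)) (f := fun _ => (0 : ℝ))
    (fun x => |K x| * C) ?_ (hK.abs.mul_const C) ?_ ?_
  · simpa using this
  · exact fun n => hK.aestronglyMeasurable.mul
      ((hG n).comp (measurableEmbedding_rescale (hh n) z).measurable).aestronglyMeasurable
  · intro n
    refine ae_of_all _ fun x => ?_
    rw [Real.norm_eq_abs, abs_mul]
    exact mul_le_mul_of_nonneg_left (hC n _) (abs_nonneg _)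
  · refine ae_of_all _ fun x => ?_
    simpa using (hlim x).const_mul (K x)

/-- A rescaled integrable kernel of total mass one is an approximate identity. -/
lemma tendsto_integral_scaledKernel_mul_sub {K : ℝ × ℝ → ℝ} (hK : Integrable K)
    (hK1 : ∫ y, K y = 1)
    {h : ℕ → ℝ × ℝ} (hh : ∀ n, 0 < (h n).1 ∧ 0 < (h n).2) (z : ℝ × ℝ)
    {G : ℕ → ℝ × ℝ → ℝ} (hG : ∀ n, Measurable (G n)) {C : ℝ} (hC : ∀ n y, |G n y| ≤ C)
    {c : ℕ → ℝ} (hc : ∀ n, |c n| ≤ C)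
    (hlim : ∀ x, Tendsto (fun n => G n (rescale (h n) z x) - c n) atTop (𝓝 0)) :
    Tendsto (fun n => (∫ y, scaledKernel K (h n) (y - z) * G n y) - c n) atTop (𝓝 0) := by
  have h1 := tendsto_integral_scaledKernel_mul_zero hK hh z (G := fun n y => G n y - c n)
    (fun n => (hG n).sub_const _) (C := C + C)
    (fun n y => (abs_sub _ _).trans (add_le_add (hC n y) (hc n))) hlim
  refine h1.congr fun n => ?_
  simp_rw [mul_sub]
  rw [integral_sub (integrable_scaledKernel_mul hK (hG n) (hC n) (hh n) z)
    (integrable_scaledKernel_mul hK measurable_const (fun _ => hc n) (hh n) z),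
    integral_scaledKernel_mul K (fun _ => c n) (hh n), integral_mul_const, hK1, one_mul]

lemma tendsto_integral_scaledKernel_mul {K : ℝ × ℝ → ℝ} (hK : Integrable K)
    (hK1 : ∫ y, K y = 1)
    {h : ℕ → ℝ × ℝ} (hh : ∀ n, 0 < (h n).1 ∧ 0 < (h n).2) (h0 : Tendsto h atTop (𝓝 (0, 0)))
    (z : ℝ × ℝ) {G : ℝ × ℝ → ℝ} (hG : Measurable G) {C : ℝ} (hC : ∀ y, |G y| ≤ C)
    (hcont : ContinuousAt G z) :
    Tendsto (fun n => ∫ y, scaledKernel K (h n) (y - z) * G y) atTop (𝓝 (G z)) := by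
  have := tendsto_integral_scaledKernel_mul_sub hK hK1 hh z (G := fun _ => G) (fun _ => hG)
    (fun _ => hC) (c := fun _ => G z) (fun _ => hC z) fun x => ?_
  · simpa using this.add_const (G z)
  · simpa using (hcont.tendsto.comp (tendsto_rescale h0 z x)).sub_const (G z)

/-! ### Population score, limiting likelihood and uniqueness of its maximum -/

variable {K f : ℝ × ℝ → ℝ} {z : ℝ × ℝ}

/-- The quadratic growth of the score is absorbed by the weighted bounds on f and ψ, uniformly for ρ
with 1 - ρ² ≥ κ. -/
lemma abs_score_mul_sub_le (hf_nonneg : ∀ y, 0 ≤ f y) {C : ℝ}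
    (hC : ∀ y : ℝ × ℝ, (1 + y.1 ^ 2 + y.2 ^ 2) * f y ≤ C) {ρ κ : ℝ}
    (hρ : ρ ∈ Set.Ioo (-1 : ℝ) 1) (hκ : 0 < κ) (hκρ : κ ≤ 1 - ρ ^ 2) (y : ℝ × ℝ) :
    |score y ρ * (f y - psi y ρ)| ≤ 2 / κ ^ 2 * (C + (Real.sqrt κ)⁻¹) := by
  have h1 : |f y - psi y ρ| ≤ f y + psi y ρ :=
    (abs_sub _ _).trans (by rw [abs_of_nonneg (hf_nonneg y), abs_of_pos (psi_pos y hρ)])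
  rw [abs_mul]
  calc _ ≤ 2 / κ ^ 2 * (1 + y.1 ^ 2 + y.2 ^ 2) * (f y + psi y ρ) :=
        mul_le_mul (abs_score_le y hρ hκ hκρ) h1 (abs_nonneg _) (by positivity)
    _ = 2 / κ ^ 2 * ((1 + y.1 ^ 2 + y.2 ^ 2) * f y + (1 + y.1 ^ 2 + y.2 ^ 2) * psi y ρ) := by ring
    _ ≤ _ := by
        gcongr
        · exact hC y
        · exact weight_mul_psi_le y hρ hκ hκρ

lemma localScore_eq (K f : ℝ × ℝ → ℝ) (h z : ℝ × ℝ) (ρ : ℝ) :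
    localScore K f h z ρ = ∫ y, scaledKernel K h (y - z) * (score y ρ * (f y - psi y ρ)) := by
  simp only [localScore, mul_assoc]

lemma continuousOn_localScore (hK : Integrable K) (hf_meas : Measurable f)
    (hf_nonneg : ∀ y, 0 ≤ f y) {C : ℝ}
    (hC : ∀ y : ℝ × ℝ, (1 + y.1 ^ 2 + y.2 ^ 2) * f y ≤ C) {h : ℝ × ℝ} (hh : 0 < h.1 ∧ 0 < h.2)
    {S : Set ℝ} (hS : IsCompact S) (hS1 : S ⊆ Set.Ioo (-1) 1) :
    ContinuousOn (localScore K f h z) S := by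
  obtain ⟨κ, hκ, hκS⟩ := exists_le_one_sub_sq hS hS1
  simp_rw [funext (localScore_eq K f h z), fun ρ => integral_scaledKernel_mul K
    (fun y => score y ρ * (f y - psi y ρ)) hh z]
  refine continuousOn_of_dominated (bound := fun x => |K x| * (2 / κ ^ 2 * (C + (Real.sqrt κ)⁻¹)))
    ?_ ?_ (hK.abs.mul_const _) ?_
  · intro ρ hρ
    refine hK.aestronglyMeasurable.mul (Measurable.aestronglyMeasurable ?_)
    exact (((continuous_score_left (hS1 hρ)).measurable.mul
      (hf_meas.sub (continuous_psi_left ρ).measurable))).comp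
      (measurableEmbedding_rescale hh z).measurable
  · intro ρ hρ
    refine ae_of_all _ fun x => ?_
    rw [Real.norm_eq_abs, abs_mul]
    exact mul_le_mul_of_nonneg_left
      (abs_score_mul_sub_le hf_nonneg hC (hS1 hρ) hκ (hκS ρ hρ) _) (abs_nonneg _)
  · refine ae_of_all _ fun x => ?_
    exact (continuousOn_const.mul ((continuousOn_score_right _).mul
      (continuousOn_const.sub (continuousOn_psi_right _)))).mono hS1

lemma tendsto_localScore (hK : Integrable K) (hK1 : ∫ y, K y = 1) (hf_meas : Measurable f)
    (hf_nonneg : ∀ y, 0 ≤ f y) {C : ℝ}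
    (hC : ∀ y : ℝ × ℝ, (1 + y.1 ^ 2 + y.2 ^ 2) * f y ≤ C) (hf_cont : ContinuousAt f z)
    {h : ℕ → ℝ × ℝ} (hh : ∀ n, 0 < (h n).1 ∧ 0 < (h n).2) (h0 : Tendsto h atTop (𝓝 (0, 0)))
    {ρ : ℝ} (hρ : ρ ∈ Set.Ioo (-1 : ℝ) 1) :
    Tendsto (fun n => localScore K f (h n) z ρ) atTop (𝓝 (score z ρ * (f z - psi z ρ))) := by
  simp_rw [localScore_eq]
  exact tendsto_integral_scaledKernel_mul hK hK1 hh h0 z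
    (G := fun y => score y ρ * (f y - psi y ρ))
    ((continuous_score_left hρ).measurable.mul (hf_meas.sub (continuous_psi_left ρ).measurable))
    (abs_score_mul_sub_le hf_nonneg hC hρ (one_sub_sq_pos hρ) le_rfl)
    ((continuous_score_left hρ).continuousAt.mul
      (hf_cont.sub (continuous_psi_left ρ).continuousAt))

/-- The limit `f(z) log ψ(z, ρ) - ψ(z, ρ)` of the local log-likelihood. -/
def limitLogLik (f : ℝ × ℝ → ℝ) (z : ℝ × ℝ) (ρ : ℝ) : ℝ := f z * Real.log (psi z ρ) - psi z ρ

lemma hasDerivAt_limitLogLik (f : ℝ × ℝ → ℝ) (z : ℝ × ℝ) {ρ : ℝ} (hρ : ρ ∈ Set.Ioo (-1 : ℝ) 1) :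
    HasDerivAt (limitLogLik f z) (score z ρ * (f z - psi z ρ)) ρ := by
  have := ((hasDerivAt_log_psi_score z hρ).const_mul (f z)).sub (hasDerivAt_psi z hρ)
  exact this.congr_deriv (by ring)

/-- This is log t < t - 1 for t = x / a ≠ 1. -/
lemma mul_log_sub_self_lt {a x : ℝ} (ha : 0 < a) (hx : 0 < x) (hne : x ≠ a) :
    a * Real.log x - x < a * Real.log a - a := by
  have h1 := Real.log_lt_sub_one_of_pos (div_pos hx ha) (by rwa [Ne, div_eq_one_iff_eq ha.ne'])
  rw [Real.log_div hx.ne' ha.ne'] at h1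
  have h2 := mul_lt_mul_of_pos_left h1 ha
  have h3 : a * (x / a - 1) = x - a := by field_simp
  nlinarith

/-- The limit attains its largest possible value at both endpoints. Since the score vanishes on no
interval, ψ(z, ·) is not constant in between, so the limit dips at some interior c; the mean value
theorem on each side of c gives the two signs. -/
lemma exists_limitLogLik_deriv_sign {a b : ℝ} (hab : a < b) (hsub : Set.Icc a b ⊆ Set.Ioo (-1) 1)
    (ha : psi z a = f z) (hb : psi z b = f z) :
    ∃ p q, a < p ∧ p < q ∧ q < b ∧ score z p * (f z - psi z p) < 0 ∧
      0 < score z q * (f z - psi z q) := by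
  obtain ⟨c, hc, hne⟩ : ∃ c ∈ Set.Ioo a b, psi z c ≠ f z := by
    by_contra! hcon
    obtain ⟨ρ, hρ, hs⟩ := exists_score_ne_zero z hab (Set.Ioo_subset_Icc_self.trans hsub)
    have hρ1 := hsub (Set.Ioo_subset_Icc_self hρ)
    have h1 : HasDerivAt (psi z) 0 ρ := by
      refine (hasDerivAt_const ρ (f z)).congr_of_eventuallyEq ?_
      filter_upwards [isOpen_Ioo.mem_nhds hρ] with r hr using hcon r hr
    exact mul_ne_zero (psi_pos z hρ1).ne' hs ((hasDerivAt_psi z hρ1).unique h1)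
  have hfz : 0 < f z := ha ▸ psi_pos z (hsub (Set.left_mem_Icc.2 hab.le))
  have hlt : limitLogLik f z c < f z * Real.log (f z) - f z :=
    mul_log_sub_self_lt hfz (psi_pos z (hsub (Set.Ioo_subset_Icc_self hc))) hne
  have hA : limitLogLik f z a = f z * Real.log (f z) - f z := by simp [limitLogLik, ha]
  have hB : limitLogLik f z b = f z * Real.log (f z) - f z := by simp [limitLogLik, hb]
  have hd : ∀ x ∈ Set.Icc a b, HasDerivAt (limitLogLik f z) (score z x * (f z - psi z x)) x :=
    fun x hx => hasDerivAt_limitLogLik f z (hsub hx)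
  obtain ⟨p, hp, hp'⟩ := exists_hasDerivAt_eq_slope (limitLogLik f z)
    (fun x => score z x * (f z - psi z x)) hc.1
    (fun x hx => (hd x ⟨hx.1, hx.2.trans hc.2.le⟩).continuousAt.continuousWithinAt)
    (fun x hx => hd x ⟨hx.1.le, (hx.2.trans hc.2).le⟩)
  obtain ⟨q, hq, hq'⟩ := exists_hasDerivAt_eq_slope (limitLogLik f z)
    (fun x => score z x * (f z - psi z x)) hc.2
    (fun x hx => (hd x ⟨hc.1.le.trans hx.1, hx.2⟩).continuousAt.continuousWithinAt)
    (fun x hx => hd x ⟨(hc.1.trans hx.1).le, hx.2.le⟩)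
  refine ⟨p, q, hp.1, hp.2.trans hq.1, hq.2, ?_, ?_⟩
  · rw [hp']; exact div_neg_of_neg_of_pos (by linarith) (by linarith [hc.1])
  · rw [hq']; exact div_pos (by linarith) (by linarith [hc.2])

/-- The level set of `ψ(z, ·)` at height `f(z)` meets the interval `J` only in `ρ₀`: two points of
it would force a zero of the population score strictly between them. -/
lemma IsLocalGaussianCorrelation.eq_of_psi_eq (hK : Integrable K) (hK1 : ∫ y, K y = 1)
    (hf_meas : Measurable f) (hf_nonneg : ∀ y, 0 ≤ f y) {C : ℝ}
    (hC : ∀ y : ℝ × ℝ, (1 + y.1 ^ 2 + y.2 ^ 2) * f y ≤ C) (hf_cont : ContinuousAt f z)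
    {J : Set ℝ} (hJ : J ⊆ Set.Ioo (-1) 1) (hJ' : J.OrdConnected) {ρ₀ : ℝ} (h₀ : ρ₀ ∈ J)
    (hρ₀ : IsLocalGaussianCorrelation K f J z ρ₀) {ρ₁ : ℝ} (h₁ : ρ₁ ∈ J)
    (h : psi z ρ₁ = f z) : ρ₁ = ρ₀ := by
  have key : ∀ a ∈ J, ∀ b ∈ J, a < b → psi z a = f z → psi z b = f z → ρ₀ ∈ Set.Ioo a b := by
    intro a ha b hb hab ha' hb'
    have hsub := hJ'.out ha hb
    obtain ⟨p, q, hap, hpq, hqb, hp, hq⟩ := exists_limitLogLik_deriv_sign hab (hsub.trans hJ) ha' hb'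
    have hpqJ : Set.Icc p q ⊆ J := (Set.Icc_subset_Icc hap.le hqb.le).trans hsub
    -- Any bandwidths tending to zero would do, since the assumption on `ρ₀` covers all such
    -- sequences.
    let g : ℕ → ℝ × ℝ := fun n => (1 / ((n : ℝ) + 1), 1 / ((n : ℝ) + 1))
    have hg : ∀ n, 0 < (g n).1 ∧ 0 < (g n).2 := fun n => ⟨by positivity, by positivity⟩
    have hg0 : Tendsto g atTop (𝓝 (0, 0)) :=
      tendsto_one_div_add_atTop_nhds_zero_nat.prodMk_nhds tendsto_one_div_add_atTop_nhds_zero_nat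
    obtain ⟨r, hr, hrlim⟩ := hρ₀.exists_unique_tendsto g hg hg0
    have e1 := (tendsto_localScore hK hK1 hf_meas hf_nonneg hC hf_cont hg hg0
      (hJ (hpqJ (Set.left_mem_Icc.2 hpq.le)))).eventually_lt_const hp
    have e2 := (tendsto_localScore hK hK1 hf_meas hf_nonneg hC hf_cont hg hg0
      (hJ (hpqJ (Set.right_mem_Icc.2 hpq.le)))).eventually_const_lt hq
    have hmem : ∀ᶠ n in atTop, r n ∈ Set.Icc p q := by
      filter_upwards [hr, e1, e2] with n hn h1 h2
      obtain ⟨ρ, hρ, hz⟩ := intermediate_value_Icc hpq.le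
        (continuousOn_localScore (z := z) hK hf_meas hf_nonneg hC (hg n) isCompact_Icc
          (hpqJ.trans hJ)) ⟨h1.le, h2.le⟩
      rwa [← (hn.2 ρ (hpqJ hρ)).1 hz]
    have := isClosed_Icc.mem_of_tendsto hrlim hmem
    exact ⟨hap.trans_le this.1, this.2.trans_lt hqb⟩
  rcases lt_trichotomy ρ₁ ρ₀ with hlt | heq | hgt
  · exact absurd (key _ h₁ _ h₀ hlt h hρ₀.population).2 (lt_irrefl _)
  · exact heq
  · exact absurd (key _ h₀ _ h₁ hgt hρ₀.population h).1 (lt_irrefl _)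

end Population

/-! ### Covariance inequalities -/

section Covariance

variable {Ω : Type*}

/-- Layer cake: each integral is the integral over (0, 1] of the measure of {Y ≥ t}, and the
integrands differ by at most α. -/
lemma abs_integral_sub_integral_le {m mΩ : MeasurableSpace Ω} (hm : m ≤ mΩ)
    (ν₁ ν₂ : Measure Ω)
    [IsFiniteMeasure ν₁] [IsFiniteMeasure ν₂] {Y : Ω → ℝ} (hY : Measurable[m] Y)
    (hY0 : ∀ ω, 0 ≤ Y ω) (hY1 : ∀ ω, Y ω ≤ 1) {α : ℝ}
    (hα : ∀ B, MeasurableSet[m] B → |ν₁.real B - ν₂.real B| ≤ α) :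
    |∫ ω, Y ω ∂ν₁ - ∫ ω, Y ω ∂ν₂| ≤ α := by
  have hint : ∀ (ν : Measure Ω) [IsFiniteMeasure ν], Integrable Y ν := fun ν _ =>
    Integrable.of_bound (hY.mono hm le_rfl).aestronglyMeasurable 1 (ae_of_all _ fun ω => by
      rw [Real.norm_eq_abs, abs_of_nonneg (hY0 ω)]; exact hY1 ω)
  have hanti : ∀ (ν : Measure Ω) [IsFiniteMeasure ν],
      IntegrableOn (fun t => ν.real {a | t ≤ Y a}) (Set.Ioc 0 1) := fun ν _ => by
    have : Antitone fun t => ν.real {a | t ≤ Y a} := fun s t hst =>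
      measureReal_mono fun a (ha : t ≤ Y a) => hst.trans ha
    exact ((this.antitoneOn _).integrableOn_isCompact isCompact_Icc).mono_set
      Set.Ioc_subset_Icc_self
  rw [(hint ν₁).integral_eq_integral_Ioc_meas_le (M := 1) (ae_of_all _ hY0) (ae_of_all _ hY1),
    (hint ν₂).integral_eq_integral_Ioc_meas_le (M := 1) (ae_of_all _ hY0) (ae_of_all _ hY1),
    ← integral_sub (hanti ν₁) (hanti ν₂)]
  have := norm_setIntegral_le_of_norm_le_const (μ := (volume : Measure ℝ)) (s := Set.Ioc 0 1)
    (f := fun t => ν₁.real {a | t ≤ Y a} - ν₂.real {a | t ≤ Y a}) (C := α) (by simp)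
    (fun t _ => hα _ (hY measurableSet_Ici))
  simpa using this

/-- The covariance inequality for variables with values in `[0, 1]`. -/
lemma abs_integral_mul_sub_le {m₁ m₂ mΩ : MeasurableSpace Ω} (μ : Measure Ω)
    [IsProbabilityMeasure μ] (hm₁ : m₁ ≤ mΩ) (hm₂ : m₂ ≤ mΩ) {α : ℝ}
    (hα : ∀ A B, MeasurableSet[m₁] A → MeasurableSet[m₂] B →
      |μ.real A * μ.real B - μ.real (A ∩ B)| ≤ α)
    {X Y : Ω → ℝ} (hX : Measurable[m₁] X) (hX0 : ∀ ω, 0 ≤ X ω) (hX1 : ∀ ω, X ω ≤ 1)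
    (hY : Measurable[m₂] Y) (hY0 : ∀ ω, 0 ≤ Y ω) (hY1 : ∀ ω, Y ω ≤ 1) :
    |∫ ω, X ω * Y ω ∂μ - (∫ ω, X ω ∂μ) * ∫ ω, Y ω ∂μ| ≤ α := by
  have hX' : Measurable X := hX.mono hm₁ le_rfl
  have hXint : Integrable X μ := Integrable.of_bound hX'.aestronglyMeasurable 1
    (ae_of_all _ fun ω => by rw [Real.norm_eq_abs, abs_of_nonneg (hX0 ω)]; exact hX1 ω)
  have hEX : 0 ≤ ∫ ω, X ω ∂μ := integral_nonneg hX0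
  -- The layer-cake bound is used twice: here with B frozen to pass from events A to X, then with X
  -- as a density to pass from B to Y.
  have step : ∀ B, MeasurableSet[m₂] B → |∫ ω in B, X ω ∂μ - (∫ ω, X ω ∂μ) * μ.real B| ≤ α := by
    intro B hB
    have : IsFiniteMeasure (ENNReal.ofReal (μ.real B) • μ) :=
      μ.smul_finite ENNReal.ofReal_ne_top
    have := abs_integral_sub_integral_le hm₁ (μ.restrict B) (ENNReal.ofReal (μ.real B) • μ)
      hX hX0 hX1 (α := α) (fun A hA => by
        rw [measureReal_restrict_apply (hm₁ _ hA), measureReal_ennreal_smul_apply,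
          ENNReal.toReal_ofReal measureReal_nonneg, abs_sub_comm, mul_comm]
        exact hα A B hA hB)
    rwa [integral_smul_measure, ENNReal.toReal_ofReal measureReal_nonneg, smul_eq_mul,
      mul_comm (μ.real B)] at this
  have : IsFiniteMeasure (ENNReal.ofReal (∫ ω, X ω ∂μ) • μ) :=
    μ.smul_finite ENNReal.ofReal_ne_top
  have : IsFiniteMeasure (μ.withDensity fun ω => ENNReal.ofReal (X ω)) :=
    isFiniteMeasure_withDensity_ofReal hXint.2
  have := abs_integral_sub_integral_le hm₂ (μ.withDensity fun ω => ENNReal.ofReal (X ω))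
    (ENNReal.ofReal (∫ ω, X ω ∂μ) • μ) hY hY0 hY1 (α := α) (fun B hB => by
      rw [measureReal_def, withDensity_apply _ (hm₂ _ hB),
        ← ofReal_integral_eq_lintegral_ofReal hXint.integrableOn (ae_of_all _ hX0),
        ENNReal.toReal_ofReal (integral_nonneg hX0), measureReal_ennreal_smul_apply,
        ENNReal.toReal_ofReal hEX]
      exact step B hB)
  rw [integral_smul_measure, ENNReal.toReal_ofReal hEX, smul_eq_mul,
    integral_withDensity_eq_integral_toReal_smul (by fun_prop) (by simp)] at this
  simpa [ENNReal.toReal_ofReal, hX0] using this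

lemma memLp_two_of_abs_le {mΩ : MeasurableSpace Ω} (μ : Measure Ω) [IsFiniteMeasure μ] {X : Ω → ℝ} (hX : Measurable X)
    {a : ℝ} (hXa : ∀ ω, |X ω| ≤ a) : MemLp X 2 μ :=
  MemLp.of_bound hX.aestronglyMeasurable a (ae_of_all _ hXa)

/-- The covariance inequality for bounded variables under `α`-mixing. -/
lemma abs_covariance_le_mixing {m₁ m₂ mΩ : MeasurableSpace Ω} (μ : Measure Ω)
    [IsProbabilityMeasure μ] (hm₁ : m₁ ≤ mΩ) (hm₂ : m₂ ≤ mΩ) {α : ℝ}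
    (hα : ∀ A B, MeasurableSet[m₁] A → MeasurableSet[m₂] B →
      |μ.real A * μ.real B - μ.real (A ∩ B)| ≤ α)
    {X Y : Ω → ℝ} (hX : Measurable[m₁] X) (hY : Measurable[m₂] Y) {a : ℝ} (ha : 0 < a)
    (hXa : ∀ ω, |X ω| ≤ a) (hYa : ∀ ω, |Y ω| ≤ a) :
    |cov[X, Y; μ]| ≤ 4 * a ^ 2 * α := by
  -- The affine map from [-a, a] onto [0, 1] scales covariances by (2a)⁻², hence the factor 4a².
  have norm_mem : ∀ x : ℝ, |x| ≤ a → 0 ≤ (x + a) / (2 * a) ∧ (x + a) / (2 * a) ≤ 1 := by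
    intro x hx
    rw [abs_le] at hx
    exact ⟨div_nonneg (by linarith) (by linarith), (div_le_one (by linarith)).2 (by linarith)⟩
  let X' : Ω → ℝ := fun ω => (X ω + a) / (2 * a)
  let Y' : Ω → ℝ := fun ω => (Y ω + a) / (2 * a)
  have hX' : Measurable[m₁] X' := (hX.add_const a).div_const (2 * a)
  have hY' : Measurable[m₂] Y' := (hY.add_const a).div_const (2 * a)
  have hb : |∫ ω, X' ω * Y' ω ∂μ - (∫ ω, X' ω ∂μ) * ∫ ω, Y' ω ∂μ| ≤ α :=
    abs_integral_mul_sub_le μ hm₁ hm₂ hα hX' (fun ω => (norm_mem _ (hXa ω)).1)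
      (fun ω => (norm_mem _ (hXa ω)).2) hY' (fun ω => (norm_mem _ (hYa ω)).1)
      (fun ω => (norm_mem _ (hYa ω)).2)
  have abs_le : ∀ x : ℝ, |x| ≤ a → |(x + a) / (2 * a)| ≤ 1 := fun x hx => by
    rw [abs_of_nonneg (norm_mem x hx).1]; exact (norm_mem x hx).2
  have hXL : MemLp X' 2 μ := memLp_two_of_abs_le μ (hX'.mono hm₁ le_rfl)
    (fun ω => abs_le _ (hXa ω))
  have hYL : MemLp Y' 2 μ := memLp_two_of_abs_le μ (hY'.mono hm₂ le_rfl)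
    (fun ω => abs_le _ (hYa ω))
  have eX : X = fun ω => 2 * a * X' ω + -a := by
    funext ω; simp only [X']; field_simp; ring
  have eY : Y = fun ω => 2 * a * Y' ω + -a := by
    funext ω; simp only [Y']; field_simp; ring
  have e : cov[X, Y; μ] = 4 * a ^ 2 * cov[X', Y'; μ] := by
    rw [eX, eY, covariance_add_const_left ((hXL.integrable (by simp)).const_mul _),
      covariance_add_const_right ((hYL.integrable (by simp)).const_mul _),
      covariance_const_mul_left, covariance_const_mul_right]
    ring
  rw [e, abs_mul, abs_of_pos (by positivity : 0 < 4 * a ^ 2), covariance_eq_sub hXL hYL]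
  exact mul_le_mul_of_nonneg_left hb (by positivity)

/-- By |xy| ≤ (x² + y²)/2 for the centred variables, only individual second moments enter, so no
joint density at two times is needed. -/
lemma abs_covariance_le_of_sq {mΩ : MeasurableSpace Ω} (μ : Measure Ω)
    [IsProbabilityMeasure μ] {X Y : Ω → ℝ}
    (hX : MemLp X 2 μ) (hY : MemLp Y 2 μ) {V : ℝ} (hXV : ∫ ω, X ω ^ 2 ∂μ ≤ V)
    (hYV : ∫ ω, Y ω ^ 2 ∂μ ≤ V) : |cov[X, Y; μ]| ≤ V := by
  have hX1 : MemLp (fun ω => X ω - μ[X]) 2 μ := hX.sub (memLp_const _)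
  have hY1 : MemLp (fun ω => Y ω - μ[Y]) 2 μ := hY.sub (memLp_const _)
  have vX : ∫ ω, (X ω - μ[X]) ^ 2 ∂μ ≤ V := by
    rw [← variance_eq_integral hX.aemeasurable]
    exact (variance_le_expectation_sq hX.1).trans hXV
  have vY : ∫ ω, (Y ω - μ[Y]) ^ 2 ∂μ ≤ V := by
    rw [← variance_eq_integral hY.aemeasurable]
    exact (variance_le_expectation_sq hY.1).trans hYV
  calc |cov[X, Y; μ]| ≤ ∫ ω, |(X ω - μ[X]) * (Y ω - μ[Y])| ∂μ := abs_integral_le_integral_abs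
    _ ≤ ∫ ω, ((X ω - μ[X]) ^ 2 + (Y ω - μ[Y]) ^ 2) / 2 ∂μ := by
        refine integral_mono (hX1.integrable_mul hY1).abs
          ((hX1.integrable_sq.add hY1.integrable_sq).div_const 2) fun ω => ?_
        simp only [abs_mul]
        nlinarith [sq_nonneg (|X ω - μ[X]| - |Y ω - μ[Y]|), sq_abs (X ω - μ[X]),
          sq_abs (Y ω - μ[Y])]
    _ = (∫ ω, (X ω - μ[X]) ^ 2 ∂μ + ∫ ω, (Y ω - μ[Y]) ^ 2 ∂μ) / 2 := by
        rw [integral_div, integral_add hX1.integrable_sq hY1.integrable_sq]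
    _ ≤ V := by linarith

end Covariance

/-! ### Mixing coefficients and the variance of an average -/

section Mixing

lemma alphaMixing_nonneg {Ω : Type*} [MeasurableSpace Ω] (μ : Measure Ω)
    (Z : ℕ → Ω → ℝ × ℝ) (m : ℕ) : 0 ≤ alphaMixing μ Z m :=
  Real.sSup_nonneg (by rintro x ⟨k, A, B, -, -, rfl⟩; exact abs_nonneg _)

lemma measurable_sigmaGen_comp {Ω : Type*} (Z : ℕ → Ω → ℝ × ℝ) {S : Set ℕ} {t : ℕ}
    (ht : t ∈ S) {φ : ℝ × ℝ → ℝ} (hφ : Measurable φ) : Measurable[sigmaGen Z S] fun ω => φ (Z t ω) := by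
  have : Measurable[sigmaGen Z S] (Z t) := by
    rw [measurable_iff_comap_le]
    exact le_iSup₂ (f := fun t (_ : t ∈ S) => MeasurableSpace.comap (Z t) inferInstance) t ht
  exact hφ.comp this

variable {Ω : Type*} [MeasurableSpace Ω] (μ : Measure Ω) [IsProbabilityMeasure μ]
  {Z : ℕ → Ω → ℝ × ℝ}

lemma sigmaGen_le (hZ : ∀ t, Measurable (Z t)) (S : Set ℕ) :
    sigmaGen Z S ≤ (inferInstance : MeasurableSpace Ω) :=
  iSup₂_le fun t _ => (hZ t).comap_le

lemma le_alphaMixing (Z : ℕ → Ω → ℝ × ℝ) (k m : ℕ) {A B : Set Ω}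
    (hA : MeasurableSet[sigmaGen Z (Set.Iic k)] A)
    (hB : MeasurableSet[sigmaGen Z (Set.Ici (k + m))] B) :
    |μ.real A * μ.real B - μ.real (A ∩ B)| ≤ alphaMixing μ Z m := by
  -- A real `sSup` is informative only for sets bounded above; here 1 is a bound, since all terms
  -- lie in [0, 1].
  refine le_csSup ⟨1, ?_⟩ ⟨k, A, B, hA, hB, rfl⟩
  rintro x ⟨k, A, B, -, -, rfl⟩
  have h1 : μ.real A * μ.real B ≤ 1 :=
    mul_le_one₀ measureReal_le_one measureReal_nonneg measureReal_le_one
  have h2 : 0 ≤ μ.real A * μ.real B := mul_nonneg measureReal_nonneg measureReal_nonneg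
  have h3 : μ.real (A ∩ B) ≤ 1 := measureReal_le_one
  have h4 : 0 ≤ μ.real (A ∩ B) := measureReal_nonneg
  exact abs_sub_le_iff.2 ⟨by linarith, by linarith⟩

lemma abs_covariance_comp_le_alphaMixing (hZ : ∀ t, Measurable (Z t)) {φ : ℝ × ℝ → ℝ}
    (hφ : Measurable φ) {a : ℝ} (ha : 0 < a) (hφa : ∀ y, |φ y| ≤ a) (s t : ℕ) :
    |cov[fun ω => φ (Z s ω), fun ω => φ (Z t ω); μ]|
      ≤ 4 * a ^ 2 * alphaMixing μ Z (s - t + (t - s)) := by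
  wlog hst : s ≤ t generalizing s t
  · rw [covariance_comm, add_comm]
    exact this t s (le_of_not_ge hst)
  refine abs_covariance_le_mixing μ (sigmaGen_le hZ (Set.Iic s))
    (sigmaGen_le hZ (Set.Ici (s + (s - t + (t - s)))))
    (fun A B hA hB => le_alphaMixing μ Z s _ hA hB)
    (measurable_sigmaGen_comp Z (Set.mem_Iic.2 le_rfl) hφ)
    (measurable_sigmaGen_comp Z (Set.mem_Ici.2 (by omega)) hφ) ha (fun ω => hφa _) fun ω => hφa _

/-- With truncated subtraction, `s - t + (t - s)` is |s - t|. Each lag occurs at most once on either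
side of s, hence the factor 2. -/
lemma sum_range_dist_le {g : ℕ → ℝ} (hg : ∀ m, 0 ≤ g m) (hs : Summable g) (n s : ℕ) :
    ∑ t ∈ Finset.range n, g (s - t + (t - s)) ≤ 2 * ∑' m, g m := by
  rw [← Finset.sum_filter_add_sum_filter_not _ (fun t => t ≤ s), two_mul]
  refine add_le_add ?_ ?_
  · rw [← Finset.sum_image (f := g) (g := fun t => s - t + (t - s))]
    · exact hs.sum_le_tsum _ fun m _ => hg m
    · intro t ht t' ht' h
      simp at ht ht' h
      omega
  · rw [← Finset.sum_image (f := g) (g := fun t => s - t + (t - s))]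
    · exact hs.sum_le_tsum _ fun m _ => hg m
    · intro t ht t' ht' h
      simp at ht ht' h
      omega

/-- Geometric interpolation between two upper bounds; it merges the second-moment and mixing bounds
on a covariance. -/
lemma le_rpow_mul_rpow {c x y b : ℝ} (hc : 0 ≤ c) (hb : 0 ≤ b) (hb1 : b ≤ 1) (hx : c ≤ x)
    (hy : c ≤ y) : c ≤ x ^ (1 - b) * y ^ b := by
  calc c = c ^ (1 - b) * c ^ b := by rw [← Real.rpow_add' hc (by simp)]; simp
    _ ≤ _ := mul_le_mul (Real.rpow_le_rpow hc hx (by linarith)) (Real.rpow_le_rpow hc hy hb)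
        (Real.rpow_nonneg hc _) (Real.rpow_nonneg (hc.trans hx) _)

lemma variance_mean_le (hZ : ∀ t, Measurable (Z t)) {φ : ℝ × ℝ → ℝ}
    (hφ : Measurable φ) {a V : ℝ} (ha : 0 < a) (hφa : ∀ y, |φ y| ≤ a)
    (hφV : ∀ t, ∫ ω, φ (Z t ω) ^ 2 ∂μ ≤ V) {b : ℝ} (hb : 0 < b) (hb1 : b ≤ 1)
    (hs : Summable fun m => alphaMixing μ Z m ^ b) (n : ℕ) :
    Var[fun ω => (n : ℝ)⁻¹ * ∑ t ∈ Finset.range n, φ (Z t ω); μ]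
      ≤ (n : ℝ)⁻¹ * (V + V ^ (1 - b) * (4 * a ^ 2) ^ b * (2 * ∑' m, alphaMixing μ Z m ^ b)) := by
  have hL : ∀ t, MemLp (fun ω => φ (Z t ω)) 2 μ := fun t =>
    memLp_two_of_abs_le μ (hφ.comp (hZ t)) fun ω => hφa _
  have hV : 0 ≤ V := (integral_nonneg fun ω => sq_nonneg _).trans (hφV 0)
  set E := V ^ (1 - b) * (4 * a ^ 2) ^ b with hE
  have hE0 : 0 ≤ E := mul_nonneg (Real.rpow_nonneg hV _) (Real.rpow_nonneg (by positivity) _)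
  have hα0 : ∀ m, 0 ≤ alphaMixing μ Z m ^ b := fun m =>
    Real.rpow_nonneg (alphaMixing_nonneg μ Z m) _
  -- The interpolated bound holds for all s and t; the diagonal V only weakens it.
  have hcov : ∀ s t, cov[fun ω => φ (Z s ω), fun ω => φ (Z t ω); μ]
      ≤ (if s = t then V else 0) + E * alphaMixing μ Z (s - t + (t - s)) ^ b := by
    intro s t
    have h1 := abs_covariance_le_of_sq μ (hL s) (hL t) (hφV s) (hφV t)
    have h2 := abs_covariance_comp_le_alphaMixing μ hZ hφ ha hφa s t
    have h3 := le_rpow_mul_rpow (abs_nonneg _) hb.le hb1 h1 h2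
    rw [Real.mul_rpow (by positivity) (alphaMixing_nonneg μ Z _), ← mul_assoc] at h3
    refine (le_abs_self _).trans (h3.trans ?_)
    have : 0 ≤ (if s = t then V else 0) := by split_ifs <;> simp [hV]
    linarith
  rw [variance_const_mul, variance_fun_sum' fun t _ => hL t]
  have hrow : ∀ s ∈ Finset.range n,
      ∑ t ∈ Finset.range n, cov[fun ω => φ (Z s ω), fun ω => φ (Z t ω); μ]
        ≤ V + E * (2 * ∑' m, alphaMixing μ Z m ^ b) := by
    intro s hsn
    refine (Finset.sum_le_sum fun t _ => hcov s t).trans ?_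
    rw [Finset.sum_add_distrib, Finset.sum_ite_eq, if_pos hsn, ← Finset.mul_sum]
    have := mul_le_mul_of_nonneg_left (sum_range_dist_le hα0 hs n s) hE0
    linarith
  have hsum := Finset.sum_le_card_nsmul _ _ _ hrow
  rw [Finset.card_range, nsmul_eq_mul] at hsum
  rcases Nat.eq_zero_or_pos n with rfl | hn
  · simp
  have hn' : (0 : ℝ) < n := Nat.cast_pos.2 hn
  calc _ ≤ ((n : ℝ)⁻¹) ^ 2 * (n * (V + E * (2 * ∑' m, alphaMixing μ Z m ^ b))) := by gcongr
    _ = _ := by field_simp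

/-- Weighted Young inequality applied to m^λ α^a and m^(-λ/(λ-a)), both summable, with weights
chosen so that the powers of m cancel. -/
lemma summable_rpow_of_summable_weighted {α : ℕ → ℝ} (hα : ∀ m, 0 ≤ α m) {lam a : ℝ} (ha : 0 < a)
    (hlam : a < lam) (hs : Summable fun m : ℕ => (m : ℝ) ^ lam * α m ^ a) :
    Summable fun m => α m ^ (a / (lam + 1 - a)) := by
  have hd : 0 < lam + 1 - a := by linarith
  have hl : 0 < lam - a := by linarith
  have hs2 : Summable fun m : ℕ => (m : ℝ) ^ (-(lam / (lam - a))) :=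
    Real.summable_nat_rpow.2 (by rw [neg_lt_neg_iff, one_lt_div hl]; linarith)
  refine Summable.of_norm_bounded_eventually_nat
    ((hs.mul_left (1 / (lam + 1 - a))).add (hs2.mul_left ((lam - a) / (lam + 1 - a)))) ?_
  filter_upwards [eventually_gt_atTop 0] with m hm
  have hm' : (0 : ℝ) < m := Nat.cast_pos.2 hm
  rw [Real.norm_eq_abs, abs_of_nonneg (Real.rpow_nonneg (hα m) _)]
  have hY := Real.geom_mean_le_arith_mean2_weighted (w₁ := 1 / (lam + 1 - a))
    (w₂ := (lam - a) / (lam + 1 - a)) (p₁ := (m : ℝ) ^ lam * α m ^ a)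
    (p₂ := (m : ℝ) ^ (-(lam / (lam - a)))) (by positivity) (by positivity)
    (mul_nonneg (by positivity) (Real.rpow_nonneg (hα m) _)) (by positivity)
    (by field_simp; ring)
  refine le_of_eq_of_le ?_ hY
  rw [Real.mul_rpow (by positivity) (Real.rpow_nonneg (hα m) _), ← Real.rpow_mul hm'.le,
    ← Real.rpow_mul hm'.le, ← Real.rpow_mul (hα m), mul_right_comm, ← Real.rpow_add hm']
  have e : lam * (1 / (lam + 1 - a)) + -(lam / (lam - a)) * ((lam - a) / (lam + 1 - a)) = 0 := by
    field_simp; ring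
  rw [e, Real.rpow_zero, one_mul, mul_one_div]

end Mixing

/-! ### Weak law for kernel averages -/

section KernelMeans

/-- Partial differentiability gives continuity in each variable separately, which suffices for joint
measurability. -/
lemma IsAdmissibleKernel.measurable {K : ℝ × ℝ → ℝ} (hK : IsAdmissibleKernel K) :
    Measurable K := by
  have := measurable_uncurry_of_continuous_of_measurable (u := fun t s : ℝ => K (t, s))
    (fun s => continuous_iff_continuousAt.2 fun t => (hK.partial_fst (t, s)).continuousAt)
    (fun t => (continuous_iff_continuousAt.2 fun s =>
      (hK.partial_snd (t, s)).continuousAt).measurable)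
  exact this

lemma measurable_scaledKernel_sub {K : ℝ × ℝ → ℝ} (hK : Measurable K) (h z : ℝ × ℝ) :
    Measurable fun y => scaledKernel K h (y - z) := by
  unfold scaledKernel
  exact (hK.comp (by fun_prop)).const_mul _

lemma abs_scaledKernel_le {K : ℝ × ℝ → ℝ} {M : ℝ} (hM : ∀ y, |K y| ≤ M) {h : ℝ × ℝ}
    (hh : 0 < h.1 ∧ 0 < h.2) (x : ℝ × ℝ) : |scaledKernel K h x| ≤ M / (h.1 * h.2) := by
  have hH : 0 < h.1 * h.2 := mul_pos hh.1 hh.2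
  rw [scaledKernel, abs_mul, abs_of_pos (inv_pos.2 hH), mul_comm, div_eq_mul_inv]
  exact mul_le_mul_of_nonneg_right (hM _) (inv_pos.2 hH).le

lemma abs_scaledKernel (K : ℝ × ℝ → ℝ) {h : ℝ × ℝ} (hh : 0 < h.1 ∧ 0 < h.2) (x : ℝ × ℝ) :
    |scaledKernel K h x| = scaledKernel (fun y => |K y|) h x := by
  rw [scaledKernel, scaledKernel, abs_mul, abs_of_pos (inv_pos.2 (mul_pos hh.1 hh.2))]

section Density

variable {Ω : Type*} [MeasurableSpace Ω] {μ : Measure Ω} {X : Ω → ℝ × ℝ} {f : ℝ × ℝ → ℝ}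

lemma integral_comp_eq_of_density (hX : Measurable X) (hf_meas : Measurable f)
    (hf_nonneg : ∀ y, 0 ≤ f y)
    (hlaw : μ.map X = volume.withDensity fun y => ENNReal.ofReal (f y))
    {φ : ℝ × ℝ → ℝ} (hφ : Measurable φ) : ∫ ω, φ (X ω) ∂μ = ∫ y, φ y * f y := by
  rw [← integral_map hX.aemeasurable hφ.aestronglyMeasurable, hlaw,
    integral_withDensity_eq_integral_toReal_smul (by fun_prop) (by simp)]
  simp [ENNReal.toReal_ofReal, hf_nonneg, mul_comm]

lemma integrable_comp_of_density (hX : Measurable X) (hf_meas : Measurable f)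
    (hf_nonneg : ∀ y, 0 ≤ f y)
    (hlaw : μ.map X = volume.withDensity fun y => ENNReal.ofReal (f y))
    {φ : ℝ × ℝ → ℝ} (hφ : Integrable fun y => φ y * f y) :
    Integrable (fun ω => φ (X ω)) μ := by
  have : Integrable φ (μ.map X) := by
    rw [hlaw, integrable_withDensity_iff_integrable_smul' (by fun_prop) (by simp)]
    simpa [ENNReal.toReal_ofReal, hf_nonneg, mul_comm] using hφ
  exact this.comp_measurable hX

end Density

/-- With both the sup bound and the second moment of size D/H, the interpolated term carries (1 - b)
+ 2b = 1 + b powers of 1/H. -/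
lemma tendsto_variance_bound {H : ℕ → ℝ} (hH : ∀ n, 0 < H n) (hH0 : Tendsto H atTop (𝓝 0))
    {b : ℝ} (hb : 0 < b)
    (hrate : Tendsto (fun n : ℕ => (n : ℝ) * H n ^ (1 + b)) atTop atTop)
    {D : ℝ} (hD : 0 < D) (A : ℝ) :
    Tendsto (fun n : ℕ => (n : ℝ)⁻¹ * (D / H n + (D / H n) ^ (1 - b) *
      (4 * (D / H n) ^ 2) ^ b * A)) atTop (𝓝 0) := by
  have hle : ∀ᶠ n : ℕ in atTop, (n : ℝ) * H n ^ (1 + b) ≤ n * H n := by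
    filter_upwards [hH0.eventually_lt_const one_pos] with n hn
    refine mul_le_mul_of_nonneg_left ?_ (Nat.cast_nonneg n)
    simpa using Real.rpow_le_rpow_of_exponent_ge (hH n) hn.le (by linarith : (1 : ℝ) ≤ 1 + b)
  have h1 := (tendsto_atTop_mono' _ hle hrate).inv_tendsto_atTop.const_mul D
  have h2 := hrate.inv_tendsto_atTop.const_mul (D ^ (1 - b) * (4 * D ^ 2) ^ b * A)
  have h3 := h1.add h2
  simp only [mul_zero, add_zero] at h3
  refine h3.congr fun n => ?_
  have e : (D / H n) ^ (1 - b) * (4 * (D / H n) ^ 2) ^ b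
      = D ^ (1 - b) * (4 * D ^ 2) ^ b * (H n ^ (1 + b))⁻¹ := by
    rw [Real.div_rpow hD.le (hH n).le, div_pow, ← mul_div_assoc,
      Real.div_rpow (by positivity) (sq_nonneg _), ← Real.rpow_natCast (H n),
      ← Real.rpow_mul (hH n).le, div_mul_div_comm, ← Real.rpow_add (hH n), div_eq_mul_inv]
    congr 3
    push_cast
    ring
  simp only [Pi.inv_apply]
  rw [e, mul_inv, mul_inv]
  ring

variable {Ω : Type*} [MeasurableSpace Ω] {μ : Measure Ω} [IsProbabilityMeasure μ]
  {Z : ℕ → Ω → ℝ × ℝ} {f : ℝ × ℝ → ℝ} {z : ℝ × ℝ} {K : ℝ × ℝ → ℝ} {h : ℕ → ℝ × ℝ}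

/-- The variance of a kernel average of a bounded statistic tends to zero under `α`-mixing. -/
lemma tendsto_variance_kernelMean (hZ : ∀ t, Measurable (Z t))
    (hf_meas : Measurable f) (hf_nonneg : ∀ y, 0 ≤ f y)
    (hlaw : ∀ t, μ.map (Z t) = volume.withDensity (fun y => ENNReal.ofReal (f y)))
    {C : ℝ} (hfC : ∀ y, f y ≤ C) (hK_meas : Measurable K) (hK : Integrable K)
    {M : ℝ} (hM : ∀ y, |K y| ≤ M)
    (hh : ∀ n, 0 < (h n).1 ∧ 0 < (h n).2) (h0 : Tendsto h atTop (𝓝 (0, 0)))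
    {b : ℝ} (hb : 0 < b) (hb1 : b ≤ 1) (hs : Summable fun m => alphaMixing μ Z m ^ b)
    (hrate : Tendsto (fun n : ℕ => (n : ℝ) * ((h n).1 * (h n).2) ^ (1 + b)) atTop atTop)
    {g : ℝ × ℝ → ℝ} (hg : Measurable g) {B : ℝ} (hgB : ∀ y, |g y| ≤ B) :
    Tendsto (fun n : ℕ => Var[fun ω => (n : ℝ)⁻¹ * ∑ t ∈ Finset.range n,
      scaledKernel K (h n) (Z t ω - z) * g (Z t ω); μ]) atTop (𝓝 0) := by
  have hM0 : 0 ≤ M := (abs_nonneg _).trans (hM 0)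
  have hB0 : 0 ≤ B := (abs_nonneg _).trans (hgB 0)
  have hC0 : 0 ≤ C := (hf_nonneg 0).trans (hfC 0)
  have hKi : 0 ≤ ∫ y, |K y| := integral_nonneg fun _ => abs_nonneg _
  have hHpos : ∀ n, 0 < (h n).1 * (h n).2 := fun n => mul_pos (hh n).1 (hh n).2
  have hH0 : Tendsto (fun n => (h n).1 * (h n).2) atTop (𝓝 0) := by
    have := ((continuous_fst.mul continuous_snd).tendsto ((0, 0) : ℝ × ℝ)).comp h0
    simpa [Function.comp_def] using this
  -- One constant for which D/H dominates both the sup norm and the second moment; the 1 ensures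
  -- positivity.
  set D : ℝ := M * B + M * (∫ y, |K y|) * (B ^ 2 * C) + 1 with hD
  have hp1 : 0 ≤ M * B := mul_nonneg hM0 hB0
  have hp2 : 0 ≤ M * (∫ y, |K y|) * (B ^ 2 * C) := by positivity
  have hD0 : 0 < D := by positivity
  refine tendsto_of_tendsto_of_tendsto_of_le_of_le tendsto_const_nhds
    (tendsto_variance_bound hHpos hH0 hb hrate hD0 (2 * ∑' m, alphaMixing μ Z m ^ b))
    (fun n => variance_nonneg _ _) fun n => ?_
  have hφ : Measurable fun y => scaledKernel K (h n) (y - z) * g y :=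
    (measurable_scaledKernel_sub hK_meas _ _).mul hg
  refine variance_mean_le μ hZ hφ (div_pos hD0 (hHpos n)) (fun y => ?_) (fun t => ?_) hb hb1 hs n
  · rw [abs_mul]
    calc _ ≤ M / ((h n).1 * (h n).2) * B :=
          mul_le_mul (abs_scaledKernel_le hM (hh n) _) (hgB y) (abs_nonneg _)
            (div_nonneg hM0 (hHpos n).le)
      _ = M * B / ((h n).1 * (h n).2) := by ring
      _ ≤ _ := div_le_div_of_nonneg_right (by linarith) (hHpos n).le
  · rw [integral_comp_eq_of_density (φ := fun y => (scaledKernel K (h n) (y - z) * g y) ^ 2)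
      (hZ t) hf_meas hf_nonneg (hlaw t) (hφ.pow_const 2)]
    have hfi : Integrable fun y => scaledKernel (fun y => |K y|) (h n) (y - z) *
        (M / ((h n).1 * (h n).2) * (B ^ 2 * C)) :=
      integrable_scaledKernel_mul hK.abs measurable_const (fun _ => le_rfl) (hh n) z
    -- One factor |K_h| is bounded by M/H and the other is integrated, so the second moment costs
    -- only one power of 1/H.
    calc ∫ y, (scaledKernel K (h n) (y - z) * g y) ^ 2 * f y
        ≤ ∫ y, scaledKernel (fun y => |K y|) (h n) (y - z) *
          (M / ((h n).1 * (h n).2) * (B ^ 2 * C)) := by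
          refine integral_mono_of_nonneg (ae_of_all _ fun y =>
            mul_nonneg (sq_nonneg _) (hf_nonneg y)) hfi (ae_of_all _ fun y => ?_)
          have e1 := abs_scaledKernel_le hM (hh n) (y - z)
          have e2 : g y ^ 2 ≤ B ^ 2 := sq_le_sq' (by linarith [abs_le.1 (hgB y)])
            (abs_le.1 (hgB y)).2
          simp only [← abs_scaledKernel K (hh n)]
          rw [mul_pow, ← sq_abs (scaledKernel K (h n) (y - z)), sq, mul_assoc, mul_assoc]
          refine mul_le_mul_of_nonneg_left ?_ (abs_nonneg _)
          exact mul_le_mul e1 (mul_le_mul e2 (hfC y) (hf_nonneg y) (sq_nonneg _))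
            (mul_nonneg (sq_nonneg _) (hf_nonneg y)) (div_nonneg hM0 (hHpos n).le)
      _ = M * (∫ y, |K y|) * (B ^ 2 * C) / ((h n).1 * (h n).2) := by
          rw [integral_scaledKernel_mul _ (fun _ => M / ((h n).1 * (h n).2) * (B ^ 2 * C)) (hh n),
            integral_mul_const]
          ring
      _ ≤ _ := div_le_div_of_nonneg_right (by linarith) (hHpos n).le

/-- A deviation of 3η needs η from the fluctuation of T (Chebyshev) or from R (Markov), as the bias
is below η. -/
lemma measureReal_deviation_le {S T R : Ω → ℝ} (hT : MemLp T 2 μ) (hR : Integrable R μ)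
    (hS : ∀ ω, S ω = T ω + R ω) {c η r : ℝ} (hη : 0 < η) (hc : |μ[T] - c| < η)
    (hr : ∫ ω, |R ω| ∂μ ≤ r) :
    μ.real {ω | 3 * η ≤ |S ω - c|} ≤ Var[T; μ] / η ^ 2 + r / η := by
  have h1 : {ω | 3 * η ≤ |S ω - c|} ⊆ {ω | η ≤ |T ω - μ[T]|} ∪ {ω | η ≤ |R ω|} := by
    intro ω hω
    by_contra hcon
    simp only [Set.mem_union, Set.mem_ofPred_eq, not_or, not_le] at hcon hω
    have e : S ω - c = (T ω - μ[T]) + R ω + (μ[T] - c) := by rw [hS]; ring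
    rw [e] at hω
    linarith [abs_add_three (T ω - μ[T]) (R ω) (μ[T] - c)]
  have h2 : μ.real {ω | η ≤ |T ω - μ[T]|} ≤ Var[T; μ] / η ^ 2 :=
    ENNReal.toReal_le_of_le_ofReal (div_nonneg (variance_nonneg _ _) (sq_nonneg _))
      (meas_ge_le_variance_div_sq hT hη)
  have h3 : μ.real {ω | η ≤ |R ω|} ≤ r / η := by
    rw [le_div_iff₀ hη, mul_comm]
    exact (mul_meas_ge_le_integral_of_nonneg (ae_of_all _ fun ω => abs_nonneg _) hR.abs η).trans hr
  exact (measureReal_mono h1).trans ((measureReal_union_le _ _).trans (add_le_add h2 h3))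

/-- Weak law of large numbers for kernel averages of a statistic of at most quadratic growth. -/
lemma tendsto_measureReal_kernelMean (hZ : ∀ t, Measurable (Z t))
    (hf_meas : Measurable f) (hf_nonneg : ∀ y, 0 ≤ f y)
    (hlaw : ∀ t, μ.map (Z t) = volume.withDensity (fun y => ENNReal.ofReal (f y)))
    (hf_cont : ContinuousAt f z)
    {C : ℝ} (hC : ∀ y : ℝ × ℝ, (1 + y.1 ^ 2 + y.2 ^ 2) * f y ≤ C)
    (hK_meas : Measurable K) (hK : Integrable K) (hK1 : ∫ y, K y = 1)
    {M : ℝ} (hM : ∀ y, |K y| ≤ M)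
    (hh : ∀ n, 0 < (h n).1 ∧ 0 < (h n).2) (h0 : Tendsto h atTop (𝓝 (0, 0)))
    {b : ℝ} (hb : 0 < b) (hb1 : b ≤ 1) (hs : Summable fun m => alphaMixing μ Z m ^ b)
    (hrate : Tendsto (fun n : ℕ => (n : ℝ) * ((h n).1 * (h n).2) ^ (1 + b)) atTop atTop)
    {g : ℝ × ℝ → ℝ} (hg : Continuous g) (hgq : ∀ y, |g y| ≤ 1 + y.1 ^ 2 + y.2 ^ 2)
    {η : ℝ} (hη : 0 < η) :
    Tendsto (fun n : ℕ => μ.real {ω | η ≤ |(n : ℝ)⁻¹ * ∑ t ∈ Finset.range n,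
      scaledKernel K (h n) (Z t ω - z) * g (Z t ω) - g z * f z|}) atTop (𝓝 0) := by
  have hfC : ∀ y, f y ≤ C := fun y => by
    refine le_trans ?_ (hC y)
    nlinarith [hf_nonneg y, mul_nonneg (sq_nonneg y.1) (hf_nonneg y),
      mul_nonneg (sq_nonneg y.2) (hf_nonneg y)]
  obtain ⟨B, hB⟩ := (isCompact_closedBall z 1).exists_bound_of_continuousOn hg.continuousOn
  have hB0 : 0 ≤ B := (norm_nonneg _).trans (hB z (by simp))
  have hU : MeasurableSet (Metric.ball z 1) := Metric.isOpen_ball.measurableSet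
  have hUn : Metric.ball z 1 ∈ 𝓝 z := Metric.ball_mem_nhds z one_pos
  -- The covariance bound needs a bounded statistic, while g may grow quadratically; outside the
  -- ball only boundedness of |g| f is used.
  set gT : ℝ × ℝ → ℝ := (Metric.ball z 1).indicator g with hgT
  set gR : ℝ × ℝ → ℝ := (Metric.ball z 1)ᶜ.indicator g with hgR
  have hsplit : ∀ y, g y = gT y + gR y := fun y =>
    (congrFun (Set.indicator_self_add_compl (Metric.ball z 1) g) y).symm
  have hgTm : Measurable gT := hg.measurable.indicator hU
  have hgRm : Measurable gR := hg.measurable.indicator hU.compl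
  have hgTB : ∀ y, |gT y| ≤ B := fun y => by
    by_cases hy : y ∈ Metric.ball z 1
    · rw [hgT, Set.indicator_of_mem hy]; exact hB y (Metric.ball_subset_closedBall hy)
    · rw [hgT, Set.indicator_of_notMem hy]; simpa using hB0
  have hgfC : ∀ y, |g y| * f y ≤ C := fun y =>
    (mul_le_mul_of_nonneg_right (hgq y) (hf_nonneg y)).trans (hC y)
  have hgT_le : ∀ y, |gT y * f y| ≤ C := fun y => by
    rw [abs_mul, abs_of_nonneg (hf_nonneg y)]
    refine (mul_le_mul_of_nonneg_right ?_ (hf_nonneg y)).trans (hgfC y)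
    exact norm_indicator_le_norm_self g y
  have hgR_le : ∀ y, |(|gR y|) * f y| ≤ C := fun y => by
    rw [abs_mul, abs_abs, abs_of_nonneg (hf_nonneg y)]
    refine (mul_le_mul_of_nonneg_right ?_ (hf_nonneg y)).trans (hgfC y)
    exact norm_indicator_le_norm_self g y
  have hTev : (fun y => gT y * f y) =ᶠ[𝓝 z] fun y => g y * f y := by
    filter_upwards [hUn] with y hy
    simp only [hgT, Set.indicator_of_mem hy]
  have hmean : Tendsto (fun n => ∫ y, scaledKernel K (h n) (y - z) * (gT y * f y)) atTop
      (𝓝 (g z * f z)) := by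
    have := tendsto_integral_scaledKernel_mul hK hK1 hh h0 z (G := fun y => gT y * f y)
      (hgTm.mul hf_meas) hgT_le ((hg.continuousAt.mul hf_cont).congr hTev.symm)
    rwa [hTev.eq_of_nhds] at this
  set r : ℕ → ℝ := fun n => ∫ y, scaledKernel (fun y => |K y|) (h n) (y - z) * (|gR y| * f y)
    with hr
  -- Each rescaled point eventually enters the ball, where `gR` vanishes.
  have hr0 : Tendsto r atTop (𝓝 0) := by
    refine tendsto_integral_scaledKernel_mul_zero hK.abs hh z (G := fun _ y => |gR y| * f y)
      (fun _ => hgRm.abs.mul hf_meas) (fun _ => hgR_le) fun x => ?_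
    refine tendsto_const_nhds.congr' ?_
    filter_upwards [(tendsto_rescale h0 z x).eventually hUn] with n hn
    rw [hgR, Set.indicator_of_notMem (by simpa using hn)]
    simp
  have hvar := tendsto_variance_kernelMean (z := z) hZ hf_meas hf_nonneg hlaw hfC hK_meas hK hM hh
    h0 hb hb1 hs hrate hgTm hgTB
  have hη3 : 0 < η / 3 := by positivity
  have hlim : Tendsto (fun n : ℕ => Var[fun ω => (n : ℝ)⁻¹ * ∑ t ∈ Finset.range n,
      scaledKernel K (h n) (Z t ω - z) * gT (Z t ω); μ] / (η / 3) ^ 2 + r n / (η / 3))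
      atTop (𝓝 0) := by
    simpa using (hvar.div_const ((η / 3) ^ 2)).add (hr0.div_const (η / 3))
  refine squeeze_zero' (Eventually.of_forall fun n => measureReal_nonneg) ?_ hlim
  filter_upwards [eventually_gt_atTop 0, hmean.eventually (Metric.ball_mem_nhds _ hη3)] with n hn hb
  have hn' : (0 : ℝ) < n := Nat.cast_pos.2 hn
  have hTm : Measurable fun y => scaledKernel K (h n) (y - z) * gT y :=
    (measurable_scaledKernel_sub hK_meas _ _).mul hgTm
  have hM0 : 0 ≤ M := (abs_nonneg _).trans (hM 0)
  have hTb : ∀ y, |scaledKernel K (h n) (y - z) * gT y| ≤ M / ((h n).1 * (h n).2) * B := fun y => by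
    rw [abs_mul]
    exact mul_le_mul (abs_scaledKernel_le hM (hh n) _) (hgTB y) (abs_nonneg _)
      (div_nonneg hM0 (mul_pos (hh n).1 (hh n).2).le)
  have hTL : ∀ t, MemLp (fun ω => scaledKernel K (h n) (Z t ω - z) * gT (Z t ω)) 2 μ := fun t =>
    memLp_two_of_abs_le μ (hTm.comp (hZ t)) fun ω => hTb _
  have hRi : ∀ t, Integrable (fun ω => scaledKernel K (h n) (Z t ω - z) * gR (Z t ω)) μ :=
    fun t => by
      refine integrable_comp_of_density (φ := fun y => scaledKernel K (h n) (y - z) * gR y)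
        (hZ t) hf_meas hf_nonneg (hlaw t) ?_
      simp_rw [mul_assoc]
      refine integrable_scaledKernel_mul (G := fun y => gR y * f y) hK (hgRm.mul hf_meas)
        (C := C) (fun y => ?_) (hh n) z
      simpa [abs_mul] using hgR_le y
  have hRm : Measurable fun y => |scaledKernel K (h n) (y - z) * gR y| :=
    ((measurable_scaledKernel_sub hK_meas _ _).mul hgRm).abs
  have hRr : ∀ t, ∫ ω, |scaledKernel K (h n) (Z t ω - z) * gR (Z t ω)| ∂μ = r n := fun t => by
    rw [integral_comp_eq_of_density (φ := fun y => |scaledKernel K (h n) (y - z) * gR y|)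
      (hZ t) hf_meas hf_nonneg (hlaw t) hRm]
    simp only [abs_mul, abs_scaledKernel K (hh n), mul_assoc, hr]
  have := measureReal_deviation_le (μ := μ)
    (S := fun ω => (n : ℝ)⁻¹ * ∑ t ∈ Finset.range n,
      scaledKernel K (h n) (Z t ω - z) * g (Z t ω))
    (T := fun ω => (n : ℝ)⁻¹ * ∑ t ∈ Finset.range n,
      scaledKernel K (h n) (Z t ω - z) * gT (Z t ω))
    (R := fun ω => (n : ℝ)⁻¹ * ∑ t ∈ Finset.range n,
      scaledKernel K (h n) (Z t ω - z) * gR (Z t ω))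
    ((memLp_finsetSum _ fun t _ => hTL t).const_mul _)
    ((integrable_finsetSum _ fun t _ => hRi t).const_mul _)
    (fun ω => by rw [← mul_add, ← Finset.sum_add_distrib]; simp only [hsplit, mul_add])
    (c := g z * f z) (r := r n) hη3 ?_ ?_
  · rwa [mul_div_cancel₀ η three_ne_zero] at this
  · rw [integral_const_mul, integral_finsetSum _ fun t _ => (hTL t).integrable (by simp)]
    simp_rw [fun t => integral_comp_eq_of_density
      (φ := fun y => scaledKernel K (h n) (y - z) * gT y) (hZ t) hf_meas hf_nonneg (hlaw t) hTm]
    rw [Finset.sum_const, Finset.card_range, nsmul_eq_mul, inv_mul_cancel_left₀ hn'.ne']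
    simpa [Real.dist_eq, mul_assoc] using hb
  · have hi := integrable_finsetSum (Finset.range n) fun t _ => (hRi t).abs
    calc _ ≤ ∫ ω, (n : ℝ)⁻¹ * ∑ t ∈ Finset.range n,
          |scaledKernel K (h n) (Z t ω - z) * gR (Z t ω)| ∂μ := by
          refine integral_mono ((integrable_finsetSum _ fun t _ => hRi t).const_mul _).abs
            (hi.const_mul _) fun ω => ?_
          simp only
          rw [abs_mul, abs_of_pos (inv_pos.2 hn')]
          exact mul_le_mul_of_nonneg_left (Finset.abs_sum_le_sum_abs _ _) (inv_pos.2 hn').le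
      _ = r n := by
          rw [integral_const_mul, integral_finsetSum _ fun t _ => (hRi t).abs]
          simp_rw [hRr]
          rw [Finset.sum_const, Finset.card_range, nsmul_eq_mul, inv_mul_cancel_left₀ hn'.ne']
      _ ≤ r n := le_rfl

end KernelMeans

/-! ### Uniform convergence of the likelihood and separation of its maximum -/

lemma abs_psi_le (y : ℝ × ℝ) {ρ κ : ℝ} (hρ : ρ ∈ Set.Ioo (-1 : ℝ) 1) (hκ : 0 < κ)
    (hκρ : κ ≤ 1 - ρ ^ 2) : |psi y ρ| ≤ (Real.sqrt κ)⁻¹ := by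
  have h0 := psi_pos y hρ
  rw [abs_of_pos h0]
  refine le_trans ?_ (weight_mul_psi_le y hρ hκ hκρ)
  nlinarith [mul_nonneg (sq_nonneg y.1) h0.le, mul_nonneg (sq_nonneg y.2) h0.le]

/-- The penalty term of the local log-likelihood converges uniformly on compact sets of
correlations. -/
lemma eventually_abs_integral_psi_sub_lt {K : ℝ × ℝ → ℝ} (hK : Integrable K)
    (hK1 : ∫ y, K y = 1) {h : ℕ → ℝ × ℝ} (hh : ∀ n, 0 < (h n).1 ∧ 0 < (h n).2)
    (h0 : Tendsto h atTop (𝓝 (0, 0))) (z : ℝ × ℝ) {S : Set ℝ} (hS : IsCompact S)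
    (hS1 : S ⊆ Set.Ioo (-1) 1) {η : ℝ} (hη : 0 < η) :
    ∀ᶠ n in atTop, ∀ ρ ∈ S,
      |(∫ y, scaledKernel K (h n) (y - z) * psi y ρ) - psi z ρ| < η := by
  classical
  rcases S.eq_empty_or_nonempty with rfl | ⟨ρ₀, hρ₀⟩
  · simp
  obtain ⟨κ, hκ, hκS⟩ := exists_le_one_sub_sq hS hS1
  -- `r n` is a correlation violating the bound whenever one exists, so convergence along this
  -- single sequence gives uniformity over S.
  have hex : ∀ n, ∃ r ∈ S, (∃ ρ ∈ S,
      η ≤ |(∫ y, scaledKernel K (h n) (y - z) * psi y ρ) - psi z ρ|) →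
      η ≤ |(∫ y, scaledKernel K (h n) (y - z) * psi y r) - psi z r| := fun n => by
    by_cases hx : ∃ ρ ∈ S, η ≤ |(∫ y, scaledKernel K (h n) (y - z) * psi y ρ) - psi z ρ|
    · obtain ⟨ρ, hρ, hle⟩ := hx
      exact ⟨ρ, hρ, fun _ => hle⟩
    · exact ⟨ρ₀, hρ₀, fun hc => absurd hc hx⟩
  choose r hrS hr using hex
  have hcpt : IsCompact (Metric.closedBall z 1 ×ˢ S) := (isCompact_closedBall z 1).prod hS
  have huc := hcpt.uniformContinuousOn_of_continuous
    (continuousOn_psi.mono (Set.prod_mono (Set.subset_univ _) hS1))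
  rw [Metric.uniformContinuousOn_iff] at huc
  have hlim := tendsto_integral_scaledKernel_mul_sub hK hK1 hh z (G := fun n y => psi y (r n))
    (fun n => (continuous_psi_left (r n)).measurable) (C := (Real.sqrt κ)⁻¹)
    (fun n y => abs_psi_le y (hS1 (hrS n)) hκ (hκS _ (hrS n))) (c := fun n => psi z (r n))
    (fun n => abs_psi_le z (hS1 (hrS n)) hκ (hκS _ (hrS n))) (fun x => by
      rw [Metric.tendsto_nhds]
      intro ε hε
      obtain ⟨δ, hδ, hδ'⟩ := huc ε hε
      filter_upwards [(tendsto_rescale h0 z x).eventually (Metric.ball_mem_nhds z hδ),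
        (tendsto_rescale h0 z x).eventually (Metric.closedBall_mem_nhds z one_pos)] with n h1 h2
      have := hδ' (rescale (h n) z x, r n) ⟨h2, hrS n⟩ (z, r n)
        ⟨Metric.mem_closedBall_self zero_le_one, hrS n⟩ (by simpa [Prod.dist_eq, hδ] using h1)
      simpa [Real.dist_eq] using this)
  filter_upwards [hlim.eventually (Metric.ball_mem_nhds _ hη)] with n hn ρ hρ
  by_contra! hcon
  have h1 := hr n ⟨ρ, hρ, hcon⟩
  rw [Real.dist_eq, sub_zero] at hn
  linarith

/-- Separates ρ from the data; the factor 1 is kept so that all three averages have the shape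
treated by the weak law. -/
lemma localLogLik_eq (K : ℝ × ℝ → ℝ) (h z : ℝ × ℝ) (n : ℕ) (X : ℕ → ℝ × ℝ) {ρ : ℝ}
    (hρ : ρ ∈ Set.Ioo (-1 : ℝ) 1) :
    localLogLik K h z n X ρ =
      (-Real.log (2 * Real.pi) - Real.log (1 - ρ ^ 2) / 2) *
        ((n : ℝ)⁻¹ * ∑ t ∈ Finset.range n, scaledKernel K h (X t - z) * 1)
      + (-(2 * (1 - ρ ^ 2))⁻¹) *
        ((n : ℝ)⁻¹ * ∑ t ∈ Finset.range n,
          scaledKernel K h (X t - z) * ((X t).1 ^ 2 + (X t).2 ^ 2))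
      + ρ * (1 - ρ ^ 2)⁻¹ *
        ((n : ℝ)⁻¹ * ∑ t ∈ Finset.range n, scaledKernel K h (X t - z) * ((X t).1 * (X t).2))
      - ∫ y : ℝ × ℝ, scaledKernel K h (y - z) * psi y ρ := by
  unfold localLogLik
  congr 1
  simp only [Finset.mul_sum, ← Finset.sum_add_distrib]
  refine Finset.sum_congr rfl fun t _ => ?_
  rw [log_psi _ hρ]
  ring

/-- The local log-likelihood is uniformly close to its limit once three kernel averages and the
penalty term are. -/
lemma abs_localLogLik_sub_limitLogLik_lt {K f : ℝ × ℝ → ℝ} {h z : ℝ × ℝ} {n : ℕ}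
    {X : ℕ → ℝ × ℝ} {ρ D η : ℝ} (hρ : ρ ∈ Set.Ioo (-1 : ℝ) 1) (hD : 0 < D)
    (h1 : |-Real.log (2 * Real.pi) - Real.log (1 - ρ ^ 2) / 2| ≤ D)
    (h2 : |-(2 * (1 - ρ ^ 2))⁻¹| ≤ D) (h3 : |ρ * (1 - ρ ^ 2)⁻¹| ≤ D)
    (e1 : |(n : ℝ)⁻¹ * ∑ t ∈ Finset.range n, scaledKernel K h (X t - z) * 1 - 1 * f z|
      < η / (4 * D))
    (e2 : |(n : ℝ)⁻¹ * ∑ t ∈ Finset.range n,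
      scaledKernel K h (X t - z) * ((X t).1 ^ 2 + (X t).2 ^ 2) - (z.1 ^ 2 + z.2 ^ 2) * f z|
      < η / (4 * D))
    (e3 : |(n : ℝ)⁻¹ * ∑ t ∈ Finset.range n,
      scaledKernel K h (X t - z) * ((X t).1 * (X t).2) - z.1 * z.2 * f z| < η / (4 * D))
    (e4 : |(∫ y : ℝ × ℝ, scaledKernel K h (y - z) * psi y ρ) - psi z ρ| < η / 4) :
    |localLogLik K h z n X ρ - limitLogLik f z ρ| < η := by
  rw [localLogLik_eq K h z n X hρ, limitLogLik, log_psi z hρ]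
  generalize (n : ℝ)⁻¹ * ∑ t ∈ Finset.range n, scaledKernel K h (X t - z) * 1 = S₁ at *
  generalize (n : ℝ)⁻¹ * ∑ t ∈ Finset.range n,
      scaledKernel K h (X t - z) * ((X t).1 ^ 2 + (X t).2 ^ 2) = S₂ at *
  generalize (n : ℝ)⁻¹ * ∑ t ∈ Finset.range n,
      scaledKernel K h (X t - z) * ((X t).1 * (X t).2) = S₃ at *
  generalize (∫ y : ℝ × ℝ, scaledKernel K h (y - z) * psi y ρ) = I at *
  generalize -Real.log (2 * Real.pi) - Real.log (1 - ρ ^ 2) / 2 = A₁ at *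
  generalize -(2 * (1 - ρ ^ 2))⁻¹ = A₂ at *
  generalize ρ * (1 - ρ ^ 2)⁻¹ = A₃ at *
  have key : ∀ a x : ℝ, |a| ≤ D → |x| < η / (4 * D) → |a * x| ≤ η / 4 := by
    intro a x ha hx
    rw [abs_mul]
    calc |a| * |x| ≤ D * (η / (4 * D)) := mul_le_mul ha hx.le (abs_nonneg _) hD.le
      _ = η / 4 := by field_simp
  have k1 := key _ _ h1 e1
  have k2 := key _ _ h2 e2
  have k3 := key _ _ h3 e3
  have e : A₁ * S₁ + A₂ * S₂ + A₃ * S₃ - I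
      - (f z * (A₁ + A₂ * (z.1 ^ 2 + z.2 ^ 2) + A₃ * (z.1 * z.2)) - psi z ρ)
      = A₁ * (S₁ - 1 * f z) + A₂ * (S₂ - (z.1 ^ 2 + z.2 ^ 2) * f z)
        + A₃ * (S₃ - z.1 * z.2 * f z) - (I - psi z ρ) := by ring
  rw [e]
  have := abs_sub (A₁ * (S₁ - 1 * f z) + A₂ * (S₂ - (z.1 ^ 2 + z.2 ^ 2) * f z)
        + A₃ * (S₃ - z.1 * z.2 * f z)) (I - psi z ρ)
  have := abs_add_three (A₁ * (S₁ - 1 * f z)) (A₂ * (S₂ - (z.1 ^ 2 + z.2 ^ 2) * f z))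
        (A₃ * (S₃ - z.1 * z.2 * f z))
  linarith

/-- Compactness upgrades the strict inequality at each ρ ≠ `ρ₀` in S to a uniform gap at distance at
least ε. -/
lemma exists_limitLogLik_gap {f : ℝ × ℝ → ℝ} {z : ℝ × ℝ} {S : Set ℝ} (hS : IsCompact S)
    (hS1 : S ⊆ Set.Ioo (-1) 1) {ρ₀ : ℝ} (hρ₀ : ρ₀ ∈ S) (h₀ : psi z ρ₀ = f z)
    (huniq : ∀ ρ ∈ S, psi z ρ = f z → ρ = ρ₀) {ε : ℝ} (hε : 0 < ε) :
    ∃ η > 0, ∀ ρ ∈ S, ε ≤ |ρ - ρ₀| → limitLogLik f z ρ + η ≤ limitLogLik f z ρ₀ := by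
  have hcl : IsClosed {ρ : ℝ | ε ≤ |ρ - ρ₀|} := isClosed_le (by fun_prop) (by fun_prop)
  have hcont : ContinuousOn (limitLogLik f z) (Set.Ioo (-1) 1) := fun ρ hρ =>
    (hasDerivAt_limitLogLik f z hρ).continuousAt.continuousWithinAt
  obtain ⟨η, hη, hle⟩ := (hS.inter_right hcl).exists_forall_le'
    (f := fun ρ => limitLogLik f z ρ₀ - limitLogLik f z ρ) (a := 0)
    (continuousOn_const.sub (hcont.mono (Set.inter_subset_left.trans hS1))) fun ρ hρ => by
      have hfz : 0 < f z := h₀ ▸ psi_pos z (hS1 hρ₀)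
      have hne : psi z ρ ≠ f z := fun hc => by
        have h1 : ε ≤ |ρ - ρ₀| := hρ.2
        rw [huniq ρ hρ.1 hc] at h1
        simp at h1
        linarith
      have := mul_log_sub_self_lt hfz (psi_pos z (hS1 hρ.1)) hne
      simp only [limitLogLik, h₀]
      linarith
  exact ⟨η, hη, fun ρ hρ hd => by linarith [hle ρ ⟨hρ, hd⟩]⟩

/-- Once H < 1, lowering the exponent increases the power, so a rate for p serves every smaller q.
-/
lemma tendsto_mul_rpow_atTop_of_rate {H : ℕ → ℝ} (hH : ∀ n, 0 < H n)
    (hH0 : Tendsto H atTop (𝓝 0)) {ε p q : ℝ} (hε : 0 < ε) (hqp : q ≤ p)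
    (hrate : (fun n : ℕ => (n : ℝ) ^ ε) =O[atTop] fun n : ℕ => (n : ℝ) * H n ^ p) :
    Tendsto (fun n : ℕ => (n : ℝ) * H n ^ q) atTop atTop := by
  obtain ⟨c, hc, hb⟩ := hrate.exists_pos
  have h1 : Tendsto (fun n : ℕ => c⁻¹ * (n : ℝ) ^ ε) atTop atTop :=
    ((tendsto_rpow_atTop hε).comp tendsto_natCast_atTop_atTop).const_mul_atTop (inv_pos.2 hc)
  refine tendsto_atTop_mono' _ ?_ h1
  filter_upwards [hb.bound, hH0.eventually_lt_const one_pos] with n hn hlt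
  rw [Real.norm_of_nonneg (by positivity), Real.norm_of_nonneg
    (mul_nonneg (Nat.cast_nonneg n) (Real.rpow_nonneg (hH n).le _))] at hn
  rw [inv_mul_le_iff₀ hc]
  refine hn.trans (mul_le_mul_of_nonneg_left (mul_le_mul_of_nonneg_left ?_ (Nat.cast_nonneg n))
    hc.le)
  exact Real.rpow_le_rpow_of_exponent_ge (hH n) hlt.le hqp

end LocalGaussian

end

/-! ### Consistency of the estimator -/

theorem theorem1 {Ω : Type*} [MeasurableSpace Ω] (μ : Measure Ω) [IsProbabilityMeasure μ]
    -- the observed pairs: identically distributed, standard normal margins, joint density `f`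
    (Z : ℕ → Ω → ℝ × ℝ) (hZ : ∀ t, Measurable (Z t))
    (f : ℝ × ℝ → ℝ) (hf_meas : Measurable f) (hf_nonneg : ∀ y, 0 ≤ f y)
    (hlaw : ∀ t, μ.map (Z t) = volume.withDensity (fun y => ENNReal.ofReal (f y)))
    (hmargin₁ : ∀ t, μ.map (fun ω => (Z t ω).1) = gaussianReal 0 1)
    (hmargin₂ : ∀ t, μ.map (fun ω => (Z t ω).2) = gaussianReal 0 1)
    -- the location, and regularity of the density
    (z : ℝ × ℝ) (hf_cont : ContinuousAt f z)
    (hf_bound : ∃ C : ℝ, ∀ y : ℝ × ℝ, (1 + y.1 ^ 2 + y.2 ^ 2) * f y ≤ C)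
    -- kernel
    (K : ℝ × ℝ → ℝ) (hK : LocalGaussian.IsAdmissibleKernel K)
    -- compact parameter space, inside an interval of admissible correlations
    (Θ J : Set ℝ) (hΘ : IsCompact Θ) (hΘJ : Θ ⊆ J) (hJ : J ⊆ Set.Ioo (-1) 1)
    (hJ_interval : J.OrdConnected)
    -- the local Gaussian correlation exists
    (ρ₀ : ℝ) (hρ₀Θ : ρ₀ ∈ Θ) (hρ₀ : LocalGaussian.IsLocalGaussianCorrelation K f J z ρ₀)
    -- mixing rate
    (lam δ : ℝ) (hδ : 2 < δ) (hlam : 1 - 2 / δ < lam)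
    (hmix : Summable (fun m : ℕ =>
      (m : ℝ) ^ lam * LocalGaussian.alphaMixing μ Z m ^ (1 - 2 / δ)))
    -- bandwidths
    (h : ℕ → ℝ × ℝ) (hh_pos : ∀ n, 0 < (h n).1 ∧ 0 < (h n).2)
    (hh_zero : Tendsto h atTop (𝓝 (0, 0)))
    (ε₀ : ℝ) (hε₀ : 0 < ε₀)
    (hh_rate : (fun n : ℕ => (n : ℝ) ^ ε₀) =O[atTop] (fun n : ℕ =>
      (n : ℝ) * ((h n).1 * (h n).2) ^ ((lam + 2 - 2 / δ) / (lam + 2 / δ))))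
    -- the local likelihood estimate
    (ρhat : ℕ → Ω → ℝ) (hρhat_mem : ∀ n ω, ρhat n ω ∈ Θ)
    (hρhat_max : ∀ n ω, IsMaxOn
      (LocalGaussian.localLogLik K (h n) z n (fun t => Z t ω)) Θ (ρhat n ω)) :
    TendstoInMeasure μ ρhat atTop (fun _ => ρ₀) := by
  obtain ⟨C, hC⟩ := hf_bound
  obtain ⟨M, hM⟩ := hK.bounded
  have hΘ1 : Θ ⊆ Set.Ioo (-1) 1 := hΘJ.trans hJ
  have huniq : ∀ ρ ∈ Θ, LocalGaussian.psi z ρ = f z → ρ = ρ₀ := fun ρ hρ he =>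
    LocalGaussian.IsLocalGaussianCorrelation.eq_of_psi_eq hK.integrable hK.integral_eq_one hf_meas
      hf_nonneg hC hf_cont hJ hJ_interval (hΘJ hρ₀Θ) hρ₀ (hΘJ hρ) he
  have hδ0 : 0 < δ := by linarith
  set a : ℝ := 1 - 2 / δ with ha
  have ha0 : 0 < a := by rw [ha, sub_pos, div_lt_one hδ0]; exact hδ
  have ha1 : a < 1 := by
    have : 0 < 2 / δ := by positivity
    linarith
  have hd : 0 < lam + 1 - a := by linarith
  set b : ℝ := a / (lam + 1 - a) with hb
  have hb0 : 0 < b := div_pos ha0 hd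
  have hb1 : b ≤ 1 := by rw [hb, div_le_one hd]; linarith
  have hs := LocalGaussian.summable_rpow_of_summable_weighted
    (fun m => LocalGaussian.alphaMixing_nonneg μ Z m) ha0 hlam hmix
  have hHpos : ∀ n, 0 < (h n).1 * (h n).2 := fun n => mul_pos (hh_pos n).1 (hh_pos n).2
  have hH0 : Tendsto (fun n => (h n).1 * (h n).2) atTop (𝓝 0) := by
    have := ((continuous_fst.mul continuous_snd).tendsto ((0, 0) : ℝ × ℝ)).comp hh_zero
    simpa [Function.comp_def] using this
  -- The right-hand side is (λ + 1 + a)/(λ + 1 - a) = 1 + 2b.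
  have hqp : 1 + b ≤ (lam + 2 - 2 / δ) / (lam + 2 / δ) := by
    have e1 : lam + 2 - 2 / δ = lam + 1 + a := by rw [ha]; ring
    have e2 : lam + 2 / δ = lam + 1 - a := by rw [ha]; ring
    rw [e1, e2, hb, le_div_iff₀ hd, add_mul, div_mul_cancel₀ _ hd.ne']
    linarith
  have hrate := LocalGaussian.tendsto_mul_rpow_atTop_of_rate hHpos hH0 hε₀ hqp hh_rate
  have wlln : ∀ g : ℝ × ℝ → ℝ, Continuous g → (∀ y, |g y| ≤ 1 + y.1 ^ 2 + y.2 ^ 2) →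
      ∀ η : ℝ, 0 < η → Tendsto (fun n : ℕ => μ.real {ω | η ≤ |(n : ℝ)⁻¹ *
        ∑ t ∈ Finset.range n, LocalGaussian.scaledKernel K (h n) (Z t ω - z) * g (Z t ω)
          - g z * f z|}) atTop (𝓝 0) := fun g hg hgq η hη =>
    LocalGaussian.tendsto_measureReal_kernelMean hZ hf_meas hf_nonneg hlaw hf_cont hC
      hK.measurable hK.integrable hK.integral_eq_one hM hh_pos hh_zero hb0 hb1 hs hrate hg hgq hη
  have hne : ∀ ρ ∈ Θ, 1 - ρ ^ 2 ≠ 0 := fun ρ hρ => (LocalGaussian.one_sub_sq_pos (hΘ1 hρ)).ne'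
  obtain ⟨D₁, hD₁⟩ := hΘ.exists_bound_of_continuousOn
    (f := fun ρ : ℝ => -Real.log (2 * Real.pi) - Real.log (1 - ρ ^ 2) / 2)
    (continuousOn_const.sub ((ContinuousOn.log (by fun_prop) hne).div_const 2))
  obtain ⟨D₂, hD₂⟩ := hΘ.exists_bound_of_continuousOn
    (f := fun ρ : ℝ => -(2 * (1 - ρ ^ 2))⁻¹)
    (ContinuousOn.inv₀ (by fun_prop) fun ρ hρ => mul_ne_zero two_ne_zero (hne ρ hρ)).neg
  obtain ⟨D₃, hD₃⟩ := hΘ.exists_bound_of_continuousOn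
    (f := fun ρ : ℝ => ρ * (1 - ρ ^ 2)⁻¹)
    (continuousOn_id.mul (ContinuousOn.inv₀ (by fun_prop) hne))
  set D : ℝ := max 1 (max D₁ (max D₂ D₃)) with hDdef
  have hD : 0 < D := lt_of_lt_of_le one_pos (le_max_left _ _)
  have hDD₁ : D₁ ≤ D := (le_max_left _ _).trans (le_max_right _ _)
  have hDD₂ : D₂ ≤ D := (le_max_left _ _).trans ((le_max_right _ _).trans (le_max_right _ _))
  have hDD₃ : D₃ ≤ D := (le_max_right _ _).trans ((le_max_right _ _).trans (le_max_right _ _))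
  rw [tendstoInMeasure_iff_measureReal_norm]
  intro ε hε
  obtain ⟨η, hη, hgap⟩ :=
    LocalGaussian.exists_limitLogLik_gap hΘ hΘ1 hρ₀Θ hρ₀.population huniq hε
  -- Half the gap, because the approximation error is paid twice: at the estimate and at `ρ₀`.
  have hη2 : 0 < η / 2 := by positivity
  have hη' : 0 < η / 2 / (4 * D) := by positivity
  have l1 := wlln (fun _ => 1) continuous_const
    (fun y => by rw [abs_one]; nlinarith [sq_nonneg y.1, sq_nonneg y.2]) _ hη'
  have l2 := wlln (fun y => y.1 ^ 2 + y.2 ^ 2) (by fun_prop)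
    (fun y => by rw [abs_of_nonneg (by positivity)]; linarith) _ hη'
  have l3 := wlln (fun y => y.1 * y.2) (by fun_prop)
    (fun y => by
      rw [abs_mul]
      nlinarith [sq_nonneg (|y.1| - |y.2|), sq_abs y.1, sq_abs y.2, sq_nonneg y.1,
        sq_nonneg y.2]) _ hη'
  have hpen := LocalGaussian.eventually_abs_integral_psi_sub_lt hK.integrable hK.integral_eq_one
    hh_pos hh_zero z hΘ hΘ1 (by positivity : 0 < η / 2 / 4)
  have l := (l1.add l2).add l3
  simp only [add_zero] at l
  refine squeeze_zero' (Eventually.of_forall fun n => measureReal_nonneg) ?_ l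
  filter_upwards [hpen] with n hn
  refine le_trans (measureReal_mono ?_)
    ((measureReal_union_le _ _).trans (add_le_add_left (measureReal_union_le _ _) _))
  -- Off the three bad events the likelihood is within η/2 of its limit on all of `Θ`, so a
  -- maximizer loses less than η in the limit and cannot be ε away from `ρ₀`. Monotonicity of μ
  -- holds for arbitrary sets, so measurability of the estimator plays no role.
  intro ω hω
  by_contra hcon
  simp only [Set.mem_union, Set.mem_ofPred_eq, not_or, not_le] at hcon hω
  have close : ∀ ρ ∈ Θ, |LocalGaussian.localLogLik K (h n) z n (fun t => Z t ω) ρ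
      - LocalGaussian.limitLogLik f z ρ| < η / 2 := fun ρ hρ =>
    LocalGaussian.abs_localLogLik_sub_limitLogLik_lt (hΘ1 hρ) hD ((hD₁ ρ hρ).trans hDD₁)
      ((hD₂ ρ hρ).trans hDD₂) ((hD₃ ρ hρ).trans hDD₃) hcon.1.1 hcon.1.2 hcon.2 (hn ρ hρ)
  have c1 := abs_lt.1 (close _ (hρhat_mem n ω))
  have c2 := abs_lt.1 (close _ hρ₀Θ)
  have c3 := hgap _ (hρhat_mem n ω) hω
  have c4 : LocalGaussian.localLogLik K (h n) z n (fun t => Z t ω) ρ₀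
      ≤ LocalGaussian.localLogLik K (h n) z n (fun t => Z t ω) (ρhat n ω) :=
    hρhat_max n ω hρ₀Θ
  linarith [c1.1, c1.2, c2.1, c2.2]
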